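/- Let $\mathbb O$ be the octonions with standard basis $e_0=1,e_1,\dots,e_7$, and write points of $\mathbb O^2\cong\mathbb R^{16}$ as $(\mathbf x_1,\mathbf x_2)$, $\mathbf x_\alpha=\sum_{p=0}^7 x_{\alpha p}e_p$. For an $\mathbb O$-valued function $F$ put $\overline\partial_\alpha F=\sum_p e_p\,\partial F/\partial x_{\alpha p}$, and for a real-valued function $f$ put $\partial_\alpha f=\sum_p (\partial f/\partial x_{\alpha p})\,\overline{e}_p$. Let $\mathcal H^2(\mathbb O)$ be the space of octonionic Hermitian $2\times2$ matrices $A=(a_{\overline\alpha\beta})$ (so $a_{\overline11},a_{\overline22}\in\mathbb R$ and $a_{\overline21}=\overline{a_{\overline12}}$), with the mixed determinant $$\det(A,B)=\tfrac12\big(a_{\overline11}b_{\overline22}+a_{\overline22}b_{\overline11}-2\operatorname{Re}(a_{\overline12}b_{\overline21})\big).$$ For real-valued $u$ let $Hess_{\mathbb O}(u)=(\overline\partial_\alpha\partial_\beta u)_{\alpha,\beta=1,2}$, and for real-valued $u,v$ let $\mathcal T(du\otimes dv)\in\mathcal H^2(\mathbb O)$ be the matrix with entries $\tfrac12(\overline\partial_\alpha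 u\,\partial_\beta v+\overline\partial_\alpha v\,\partial_\beta u)$. A $C^1$ function $\omega=(\omega_{\overline\alpha\beta})$ with values in $\mathcal H^2(\mathbb O)$ is called closed on an open set $\Omega$ if $\sum_p (\partial\omega_{\overline\alpha\beta}/\partial x_{\beta p})\,e_p=\overline\partial_\alpha\,\omega_{\overline\beta\beta}$ on $\Omega$ for $(\alpha,\beta)=(1,2)$ and $(2,1)$. **Lemma.** Let $\Omega\subset\mathbb O^2$ be a bounded domain with a $C^1(\overline\Omega)$ defining function $\varrho$, i.e. $\varrho\in C^1(\overline\Omega)$ is real-valued, $\varrho<0$ on $\Omega$, and $\varrho=0$ and $\operatorname{grad}\varrho\neq0$ on $\partial\Omega$. Let $u\in C^2(\overline\Omega)$ and $v\in C^1(\overline\Omega)$ be real-valued, and let $\omega\in C^1(\overline\Omega,\mathcal H^2(\mathbb O))$ be closed on $\Omega$. Then the following three integrals converge absolutely and $$\int_\Omega v\,\det(Hess_{\mathbb O}(u),\omega)\,dV=-\int_\Omega\det(\mathcal T(du\otimes dv),\omega)\,dV+\int_{\partial\Omega}v\,\det(\mathcal T(du\otimes d\varrho),\omega)\,\frac{dS}{|\operatorname{grad}\varrho|},$$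 where $dV$ is Lebesgue measure on $\mathbb O^2\cong\mathbb R^{16}$ and $dS$ is the surface measure of $\partial\Omega$. (Derivatives at boundary points are those of the functions on $\overline\Omega$, i.e. the continuous extensions of the derivatives in $\Omega$.) -/

import Mathlib

open MeasureTheory

noncomputable section

/-! ### Octonions -/

/-- The octonions as a Euclidean space: `x p` is the coefficient of the basis element `e_p` in
`x = ∑ p, x p • e_p`, with `e_0 = 1`. -/
abbrev Octonion : Type := EuclideanSpace ℝ (Fin 8)

namespace Octonion

/-- The quaternion `a` in the decomposition `x = (a, b)` of an octonion. -/
def fst (x : Octonion) : Quaternion ℝ := ⟨x 0, x 1, x 2, x 3⟩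

/-- The quaternion `b` in the decomposition `x = (a, b)` of an octonion. -/
def snd (x : Octonion) : Quaternion ℝ := ⟨x 4, x 5, x 6, x 7⟩

/-- The octonion `(a, b)`. -/
def mk (a b : Quaternion ℝ) : Octonion :=
  !₂[a.re, a.imI, a.imJ, a.imK, b.re, b.imI, b.imJ, b.imK]

/-- Octonionic multiplication, `(a, b) (c, d) = (a c - d̄ b, d a + b c̄)`. -/
instance instMul : Mul Octonion where
  mul x y := mk (x.fst * y.fst - star y.snd * x.snd) (y.snd * x.fst + x.snd * star y.fst)

/-- Octonionic conjugation, `(a, b) ↦ (ā, -b)`. -/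
instance instStar : Star Octonion where
  star x := mk (star x.fst) (-x.snd)

/-- The real part of an octonion. -/
def re (x : Octonion) : ℝ := x 0

/-- The basis element `e_p`. -/
def e (p : Fin 8) : Octonion := EuclideanSpace.single p 1

end Octonion

/-- The octonionic plane `𝕆²` with its Euclidean structure; `x (α, p)` is the real coordinate
`x_{α p}`, i.e. the coefficient of `e_p` in the `α`-th octonionic coordinate. -/
abbrev OctonionPlane : Type := EuclideanSpace ℝ (Fin 2 × Fin 8)

/-- Octonionic `2 × 2` matrices; the octonionic Hermitian ones are those with
`Matrix.IsHermitian`. -/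
abbrev OctonionMatrix : Type := Matrix (Fin 2) (Fin 2) Octonion

namespace OctonionPlane

/-! ### Differential operators

The derivatives are taken within a set `s`. At points of the interior of `s` these are the usual
ones. For `s = closure Ω`, where `Ω` is a domain with `C¹` boundary, the values at boundary points
are the continuous extensions of the derivatives in `Ω`. -/

/-- The partial derivative `∂f/∂x_{α p}` (within `s`). -/
def pderiv {F : Type*} [NormedAddCommGroup F] [NormedSpace ℝ F] (s : Set OctonionPlane)
    (α : Fin 2) (p : Fin 8) (f : OctonionPlane → F) (x : OctonionPlane) : F :=
  fderivWithin ℝ f s x (EuclideanSpace.single (α, p) 1)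

/-- The left Dirac operator `∂̄_α F = ∑ p, e_p ∂F/∂x_{α p}` on octonion-valued functions. -/
def dbar (s : Set OctonionPlane) (α : Fin 2) (F : OctonionPlane → Octonion)
    (x : OctonionPlane) : Octonion :=
  ∑ p : Fin 8, Octonion.e p * pderiv s α p F x

/-- The right Dirac operator `∑ p, (∂F/∂x_{α p}) e_p` on octonion-valued functions. -/
def dbarRight (s : Set OctonionPlane) (α : Fin 2) (F : OctonionPlane → Octonion)
    (x : OctonionPlane) : Octonion :=
  ∑ p : Fin 8, pderiv s α p F x * Octonion.e p

/-- `∂_α u = ∑ p, (∂u/∂x_{α p}) ē_p` for a scalar function `u`. -/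
def dScalar (s : Set OctonionPlane) (α : Fin 2) (u : OctonionPlane → ℝ)
    (x : OctonionPlane) : Octonion :=
  ∑ p : Fin 8, pderiv s α p u x • star (Octonion.e p)

/-- For a scalar function `u`, its differential `du` as the column vector `(∂̄_1 u, ∂̄_2 u)`
of octonions, where `∂̄_α u = ∑ p, (∂u/∂x_{α p}) e_p`. -/
def differential (s : Set OctonionPlane) (u : OctonionPlane → ℝ) (x : OctonionPlane) :
    Fin 2 → Octonion :=
  fun α => ∑ p : Fin 8, pderiv s α p u x • Octonion.e p

/-- The octonionic Hessian, the matrix with entries `∂̄_α ∂_β u`. -/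
def hess (s : Set OctonionPlane) (u : OctonionPlane → ℝ) (x : OctonionPlane) : OctonionMatrix :=
  Matrix.of fun α β => dbar s α (dScalar s β u) x

end OctonionPlane

namespace OctonionMatrix

/-- The mixed determinant
`det (A, B) = (a₁₁ b₂₂ + a₂₂ b₁₁ - 2 Re (a₁₂ b₂₁)) / 2` of octonionic Hermitian matrices
(whose diagonal entries are real, so that they are equal to their real parts). -/
def mixedDet (A B : OctonionMatrix) : ℝ :=
  (1 / 2) * ((A 0 0).re * (B 1 1).re + (A 1 1).re * (B 0 0).re
    - 2 * (A 0 1 * B 1 0).re)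

/-- `ξ ⊗ η^*`, the matrix with entries `ξ_α * conj (η_β)`. -/
def tensorStar (ξ η : Fin 2 → Octonion) : OctonionMatrix :=
  Matrix.of fun α β => ξ α * star (η β)

/-- `𝒯 (ξ ⊗ η) = (ξ ⊗ η^* + η ⊗ ξ^*) / 2`. -/
def symTensor (ξ η : Fin 2 → Octonion) : OctonionMatrix :=
  (1 / 2 : ℝ) • (tensorStar ξ η + tensorStar η ξ)

end OctonionMatrix

namespace OctonionPlane

/-- A matrix-valued function `ω` is closed on the open set `Ω` if
`∑ p, (∂ω_{αβ}/∂x_{βp}) e_p = ∑ p, e_p ∂ω_{ββ}/∂x_{αp}` on `Ω` for `α ≠ β`. -/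
def IsClosedOn (Ω : Set OctonionPlane) (ω : OctonionPlane → OctonionMatrix) : Prop :=
  ∀ x ∈ Ω, ∀ α β : Fin 2, α ≠ β →
    dbarRight Ω β (fun y => ω y α β) x = dbar Ω α (fun y => ω y β β) x

/-- `ϱ` is a defining function of `Ω` of class `C¹` on the closure of `Ω`: it is negative on `Ω`,
it vanishes on the boundary and its gradient does not vanish on the boundary. -/
structure IsDefiningFunction (Ω : Set OctonionPlane) (ϱ : OctonionPlane → ℝ) : Prop where
  contDiffOn : ContDiffOn ℝ 1 ϱ (closure Ω)
  neg : ∀ x ∈ Ω, ϱ x < 0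
  eq_zero : ∀ x ∈ frontier Ω, ϱ x = 0
  grad_ne_zero : ∀ x ∈ frontier Ω, gradientWithin ϱ (closure Ω) x ≠ 0

/-- The surface measure `dS` on the boundary of `Ω`: the (normalized) 15-dimensional Hausdorff
measure restricted to the boundary. -/
def surfaceMeasure (Ω : Set OctonionPlane) : Measure OctonionPlane :=
  (Measure.euclideanHausdorffMeasure 15).restrict (frontier Ω)

end OctonionPlane

end

/-! The formula is integration by parts. For Hermitian `B` the number `mixedDet (symTensor ξ η) B`
is real-linear in `η`, so it is the inner product of `η` with a vector field, `flux ξ B`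
(`mixedDet_symTensor`). Put `G = flux (du) ω` and apply the divergence theorem to `v G`. The term
`⟪dv, G⟫` is the integrand with `𝒯(du ⊗ dv)`. Since the outer normal is `grad ϱ / |grad ϱ|`, the
boundary term is `v ⟪dϱ, G⟫ / |grad ϱ|`. It remains to see that `div G = det(Hess u, ω)`
(`sum_flux_deriv`, `sum_pderiv_flux`): closedness cancels all terms with derivatives of `ω`, and the
symmetry of second derivatives makes the two off-diagonal sums equal. Nonassociativity does no harm,
because products enter only through inner products, where a factor moves to the other side as its
conjugate.

The divergence theorem for a bounded `C¹` domain, with Hausdorff measure on the boundary, is proved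
without charts. Near a boundary point with normal `n`, the domain contains, locally, cones of
directions almost as wide as a half-space (`HasInnerCone`). Let `φ ≥ 0` vanish on `closure Ω` off a
compact subset of such a neighbourhood, and let `w` be a unit vector with `⟪n, w⟫ > ε`. A line of
direction `w` meets the relevant boundary at most once, so `∂_w φ` integrates along it to the value
of `φ` at the crossing, or to `0`. By Fubini, `L w = ∫_Ω ∂_w φ` is an integral over the projected
boundary. Projections do not increase area, hence `L w ≤ I = ∫_{∂Ω} φ dS`; the projection along `n`
is almost isometric on the boundary, hence `L n` is almost `I`.

A linear functional bounded by `I` on the unit vectors near `n` and almost attaining `I` at `n` is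
almost `I ⟪n, ·⟫` (`abs_sub_inner_mul_le`). The error is a small multiple of `I`, so it adds up
under a partition of unity to a small multiple of the whole boundary integral, and then tends to
zero. -/

noncomputable section

open Set Filter Topology
open scoped RealInnerProductSpace ENNReal NNReal

/-! ### Fubini over parallel lines -/

section LineDecomposition

variable {E : Type*} [NormedAddCommGroup E] [InnerProductSpace ℝ E] [FiniteDimensional ℝ E]
  [MeasurableSpace E] [BorelSpace E]

/-- The decomposition of `E` into the lines of direction `w`, as a volume preserving map. -/
theorem exists_measurePreserving_orthogonal_add_smul {w : E} (hw : ‖w‖ = 1) :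
    ∃ e : (ℝ ∙ w)ᗮ × ℝ ≃ᵐ E, MeasurePreserving e ∧ ∀ q, e q = (q.1 : E) + q.2 • w := by
  let f : ℝ ≃ₗᵢ[ℝ] (ℝ ∙ w) := LinearIsometryEquiv.toSpanUnitSingleton w hw
  let g : (ℝ ∙ w)ᗮ × ℝ ≃ᵐ (ℝ ∙ w)ᗮ × (ℝ ∙ w) :=
    (MeasurableEquiv.refl _).prodCongr f.toMeasurableEquiv
  let h : (ℝ ∙ w)ᗮ × (ℝ ∙ w) ≃ᵐ E := MeasurableEquiv.prodComm.trans
    ((ℝ ∙ w).measurableEquivProd (0 : E)).symm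
  refine ⟨g.trans h, ?_, ?_⟩
  · have hg : MeasurePreserving g :=
      (MeasurePreserving.id _).prod f.measurePreserving
    have hh : MeasurePreserving h := by
      have h2 := ((ℝ ∙ w).measurePreserving_measurableEquivProd (0 : E)).symm
      rw [InnerProductSpace.euclideanHausdorffMeasure_eq_volume] at h2
      exact (Measure.measurePreserving_swap).trans h2
    exact hg.trans hh
  · intro q
    simp only [g, h, f, MeasurableEquiv.prodComm, MeasurableEquiv.trans_apply,
      MeasurableEquiv.coe_mk, Submodule.measurableEquivProd_symm_apply, vadd_eq_add, add_zero]
    exact add_comm _ _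

omit [FiniteDimensional ℝ E] [MeasurableSpace E] [BorelSpace E] in
/-- The orthogonal projection onto the hyperplane orthogonal to a unit vector. -/
theorem orthogonalProjectionOnto_orthogonal_add_smul {w : E} (hw : ‖w‖ = 1) (x : E) :
    ((ℝ ∙ w)ᗮ.orthogonalProjectionOnto x : E) + ⟪w, x⟫ • w = x := by
  have h1 := (ℝ ∙ w).starProjection_add_starProjection_orthogonal x
  rw [Submodule.starProjection_unit_singleton ℝ hw] at h1
  rw [add_comm]
  exact h1

omit [FiniteDimensional ℝ E] [MeasurableSpace E] [BorelSpace E] in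
theorem finrank_orthogonal_span_singleton_of_unit {d : ℕ} (hd : Module.finrank ℝ E = d + 1)
    {w : E} (hw : ‖w‖ = 1) : Module.finrank ℝ (ℝ ∙ w)ᗮ = d := by
  have : Fact (Module.finrank ℝ E = d + 1) := ⟨hd⟩
  exact Submodule.finrank_orthogonal_span_singleton (by rintro rfl; simp at hw)

end LineDecomposition

/-! ### Area distortion of projections onto hyperplanes -/

section HausdorffLipschitz

theorem LipschitzOnWith.euclideanHausdorffMeasure_image_le {X Y : Type*} [EMetricSpace X]
    [EMetricSpace Y] [MeasurableSpace X] [BorelSpace X] [MeasurableSpace Y] [BorelSpace Y]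
    {K : ℝ≥0} {f : X → Y} {s : Set X} (hf : LipschitzOnWith K f s) (d : ℕ) :
    Measure.euclideanHausdorffMeasure d (f '' s) ≤
      (K : ℝ≥0∞) ^ d * Measure.euclideanHausdorffMeasure d s := by
  simp_rw [Measure.euclideanHausdorffMeasure_def, Measure.smul_apply]
  have := hf.hausdorffMeasure_image_le (d := d) (by positivity)
  rw [ENNReal.rpow_natCast] at this
  rw [mul_smul_comm]
  gcongr

variable {E : Type*} [NormedAddCommGroup E] [InnerProductSpace ℝ E] [FiniteDimensional ℝ E]
  [MeasurableSpace E] [BorelSpace E]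

/-- Projecting a compact set onto a hyperplane does not increase its area. -/
theorem volume_restrict_image_projection_le_map {d : ℕ} (hd : Module.finrank ℝ E = d + 1)
    {w : E} (hw : ‖w‖ = 1) (A : Set E) :
    (volume.restrict ((ℝ ∙ w)ᗮ.orthogonalProjectionOnto '' A)) ≤
      ((Measure.euclideanHausdorffMeasure d).restrict A).map (ℝ ∙ w)ᗮ.orthogonalProjectionOnto := by
  set P := (ℝ ∙ w)ᗮ.orthogonalProjectionOnto
  have hP : Measurable P := P.continuous.measurable
  refine Measure.le_iff.2 fun S hS => ?_
  rw [Measure.map_apply hP hS, Measure.restrict_apply hS, Measure.restrict_apply (hP hS),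
    ← InnerProductSpace.euclideanHausdorffMeasure_eq_volume,
    finrank_orthogonal_span_singleton_of_unit hd hw]
  have h1 : S ∩ P '' A = P '' (P ⁻¹' S ∩ A) := by
    rw [image_preimage_inter]
  rw [h1]
  have h2 := ((ℝ ∙ w)ᗮ.lipschitzWith_orthogonalProjectionOnto.lipschitzOnWith
    (s := P ⁻¹' S ∩ A)).euclideanHausdorffMeasure_image_le d
  simpa using h2

/-- On a set which is nearly orthogonal to `n`, the projection along `n` nearly preserves
the area. -/
theorem map_projection_restrict_le {d : ℕ} (hd : Module.finrank ℝ E = d + 1)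
    {n : E} (hn : ‖n‖ = 1) {ε : ℝ} (hε : ε < 1) {A : Set E}
    (hA : ∀ x ∈ A, ∀ y ∈ A, |⟪n, y - x⟫| ≤ ε * ‖y - x‖) :
    ((Measure.euclideanHausdorffMeasure d).restrict A).map (ℝ ∙ n)ᗮ.orthogonalProjectionOnto ≤
      (ENNReal.ofReal ((1 - ε)⁻¹) ^ d) •
        volume.restrict ((ℝ ∙ n)ᗮ.orthogonalProjectionOnto '' A) := by
  set P := (ℝ ∙ n)ᗮ.orthogonalProjectionOnto
  have hP : Measurable P := P.continuous.measurable
  have h0 : 0 < 1 - ε := by linarith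
  -- Splitting `y - x` along `n` gives `‖y - x‖ ≤ ‖P y - P x‖ + ε ‖y - x‖`, so the inverse of `P` on
  -- `A` is `(1 - ε)⁻¹`-Lipschitz.
  have key : ∀ x ∈ A, ∀ y ∈ A, ‖y - x‖ ≤ (1 - ε)⁻¹ * ‖P y - P x‖ := by
    intro x hx y hy
    rw [inv_mul_eq_div, le_div_iff₀ h0]
    have h1 := orthogonalProjectionOnto_orthogonal_add_smul hn (y - x)
    have h2 : ‖y - x‖ ≤ ‖P y - P x‖ + |⟪n, y - x⟫| := by
      calc ‖y - x‖ = ‖(P (y - x) : E) + ⟪n, y - x⟫ • n‖ := by rw [h1]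
        _ ≤ ‖(P (y - x) : E)‖ + ‖⟪n, y - x⟫ • n‖ := norm_add_le _ _
        _ = _ := by rw [norm_smul, hn, mul_one, Real.norm_eq_abs, map_sub]; rfl
    linarith [hA x hx y hy]
  refine Measure.le_iff.2 fun S hS => ?_
  rw [Measure.map_apply hP hS, Measure.smul_apply, Measure.restrict_apply hS,
    Measure.restrict_apply (hP hS),
    ← InnerProductSpace.euclideanHausdorffMeasure_eq_volume,
    finrank_orthogonal_span_singleton_of_unit hd hn]
  have h1 : S ∩ P '' A = P '' (P ⁻¹' S ∩ A) := by
    rw [image_preimage_inter]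
  rw [h1]
  set B := P ⁻¹' S ∩ A
  have hinj : InjOn P B := by
    intro x hx y hy hxy
    have := key x hx.2 y hy.2
    rw [hxy, sub_self, norm_zero, mul_zero] at this
    exact (sub_eq_zero.1 (norm_le_zero_iff.1 this)).symm
  have hlip : LipschitzOnWith ((1 - ε)⁻¹).toNNReal (Function.invFunOn P B) (P '' B) := by
    refine LipschitzOnWith.of_dist_le_mul ?_
    rintro _ ⟨x, hx, rfl⟩ _ ⟨y, hy, rfl⟩
    rw [hinj.leftInvOn_invFunOn hx, hinj.leftInvOn_invFunOn hy, dist_eq_norm, dist_eq_norm,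
      Real.coe_toNNReal _ (by positivity)]
    exact key y hy.2 x hx.2
  have h2 := hlip.euclideanHausdorffMeasure_image_le d
  rwa [hinj.leftInvOn_invFunOn.image_image] at h2

end HausdorffLipschitz

/-! ### The interior cone condition -/

section Cone

variable {E : Type*} [NormedAddCommGroup E] [InnerProductSpace ℝ E]

/-- Inside `U`, the set `Ω` contains with each point the cone of aperture `ε` around `-n` with
that point as its apex. -/
def HasInnerCone (Ω U : Set E) (n : E) (ε : ℝ) : Prop :=
  ∀ x ∈ Ω ∩ U, ∀ w : E, ε * ‖w‖ ≤ ⟪n, w⟫ → x - w ∈ U → x - w ∈ Ω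

namespace HasInnerCone

variable {Ω U : Set E} {n : E} {ε : ℝ}

/-- The strict inequality is an open condition: replace the apex `x` by a nearby `y ∈ Ω` and `w` by
`w + (y - x)`, which leaves the endpoint unchanged. -/
theorem sub_mem (h : HasInnerCone Ω U n ε) (hU : IsOpen U) {x w : E}
    (hx : x ∈ closure Ω) (hxU : x ∈ U) (hw : ε * ‖w‖ < ⟪n, w⟫) (hxw : x - w ∈ U) :
    x - w ∈ Ω := by
  have h1 : ∀ᶠ y in 𝓝 x, ε * ‖w + (y - x)‖ < ⟪n, w + (y - x)⟫ := by
    have hc1 : ContinuousAt (fun y => ε * ‖w + (y - x)‖) x := by fun_prop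
    have hc2 : ContinuousAt (fun y => ⟪n, w + (y - x)⟫) x := by fun_prop
    exact hc1.eventually_lt hc2 (by simpa using hw)
  obtain ⟨y, hyΩ, hy, hyU⟩ := ((mem_closure_iff_frequently.1 hx).and_eventually
    (h1.and (hU.mem_nhds hxU))).exists
  have h2 : y - (w + (y - x)) = x - w := by abel
  rw [← h2] at hxw ⊢
  exact h y ⟨hyΩ, hyU⟩ _ hy.le hxw

/-- Otherwise one of the two boundary points would lie in the open cone below the other, hence in
the open set `Ω`. Thus the boundary is a Lipschitz graph over the hyperplane orthogonal to `n`, with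
small constant. -/
theorem abs_inner_frontier_le (h : HasInnerCone Ω U n ε) (hΩ : IsOpen Ω) (hU : IsOpen U) {x y : E}
    (hx : x ∈ frontier Ω ∩ U) (hy : y ∈ frontier Ω ∩ U) :
    |⟪n, y - x⟫| ≤ ε * ‖y - x‖ := by
  have key : ∀ x ∈ frontier Ω ∩ U, ∀ y ∈ frontier Ω ∩ U, ⟪n, y - x⟫ ≤ ε * ‖y - x‖ := by
    intro x hx y hy
    by_contra! hlt
    have := h.sub_mem hU (frontier_subset_closure hy.1) hy.2 hlt (by simpa using hx.2)
    rw [sub_sub_cancel] at this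
    rw [hΩ.frontier_eq] at hx
    exact hx.1.2 this
  refine abs_le.2 ⟨?_, key x hx y hy⟩
  have := key y hy x hx
  rw [← neg_sub y x, inner_neg_right, norm_neg] at this
  linarith

/-- Near `x` the closure contains the part in a ball of an open convex cone with apex `x`, and a
convex set with interior has unique derivatives at points of its closure. -/
theorem uniqueDiffWithinAt_closure (h : HasInnerCone Ω U n ε) (hU : IsOpen U) (hn : ‖n‖ = 1)
    (hε : ε < 1) (hε0 : 0 ≤ ε) {x : E} (hx : x ∈ closure Ω) (hxU : x ∈ U) :
    UniqueDiffWithinAt ℝ (closure Ω) x := by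
  obtain ⟨r, hr, hrU⟩ := Metric.isOpen_iff.1 hU x hxU
  let C : Set E := {y | ε * ‖x - y‖ < ⟪n, x - y⟫}
  have hCo : IsOpen C := isOpen_lt (by fun_prop) (by fun_prop)
  have hCc : Convex ℝ C := by
    intro y hy z hz a b ha hb hab
    have e1 : x - (a • y + b • z) = a • (x - y) + b • (x - z) := by
      rw [smul_sub, smul_sub]
      nth_rewrite 1 [← one_smul ℝ x, ← hab]
      module
    simp only [C, mem_ofPred_eq] at hy hz ⊢
    rw [e1, inner_add_right, inner_smul_right, inner_smul_right]
    have h1 : ‖a • (x - y) + b • (x - z)‖ ≤ a * ‖x - y‖ + b * ‖x - z‖ := by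
      refine (norm_add_le _ _).trans ?_
      rw [norm_smul, norm_smul, Real.norm_of_nonneg ha, Real.norm_of_nonneg hb]
    have h2 := mul_le_mul_of_nonneg_left h1 hε0
    rcases ha.eq_or_lt with rfl | ha
    · have : b = 1 := by linarith
      subst this
      simp only [zero_smul, one_smul, zero_add, zero_mul, one_mul] at h2 ⊢
      linarith
    · have h3 := mul_lt_mul_of_pos_left hy ha
      have h4 := mul_le_mul_of_nonneg_left hz.le hb
      linarith
  have hsub : C ∩ Metric.ball x r ⊆ closure Ω := by
    rintro y ⟨hyC, hyr⟩
    have := h.sub_mem hU (w := x - y) hx hxU hyC (by simpa using hrU hyr)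
    rw [sub_sub_cancel] at this
    exact subset_closure this
  have hmem : ∀ t ∈ Ioo (0 : ℝ) r, x - t • n ∈ C ∩ Metric.ball x r := by
    intro t ht
    constructor
    · simp only [C, mem_ofPred_eq, sub_sub_cancel, inner_smul_right, norm_smul,
        real_inner_self_eq_norm_sq, hn, Real.norm_of_nonneg ht.1.le]
      have := mul_lt_mul_of_pos_right hε ht.1
      linarith
    · rw [Metric.mem_ball, dist_eq_norm, sub_sub_cancel_left, norm_neg, norm_smul, hn,
        Real.norm_of_nonneg ht.1.le, mul_one]
      exact ht.2
  have hxc : x ∈ closure (C ∩ Metric.ball x r) := by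
    have ht : Tendsto (fun t : ℝ => x - t • n) (𝓝[>] 0) (𝓝 x) := by
      have : ContinuousAt (fun t : ℝ => x - t • n) 0 := by fun_prop
      have h2 := this.tendsto
      simp only [zero_smul, sub_zero] at h2
      exact h2.mono_left nhdsWithin_le_nhds
    exact mem_closure_of_tendsto ht (by
      filter_upwards [Ioo_mem_nhdsGT hr] with t ht using hmem t ht)
  have hopen : IsOpen (C ∩ Metric.ball x r) := hCo.inter Metric.isOpen_ball
  refine (uniqueDiffWithinAt_convex (hCc.inter (convex_ball x r)) ?_ hxc).mono hsub
  rw [hopen.interior_eq]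
  exact ⟨_, hmem (r / 2) ⟨by linarith, by linarith⟩⟩

end HasInnerCone

/-- A function which is negative on `Ω` and vanishes on the boundary, and whose derivative is
close to a fixed one on `Ω ∩ U`, makes `Ω` satisfy a cone condition in `U`. -/
theorem hasInnerCone_of_norm_fderiv_sub_le {Ω U : Set E} (hΩ : IsOpen Ω) (hU : Convex ℝ U)
    {ρ : E → ℝ} (hc : ContinuousOn ρ (closure Ω)) (hneg : ∀ x ∈ Ω, ρ x < 0)
    (hzero : ∀ x ∈ frontier Ω, ρ x = 0) {ρ' : E → E →L[ℝ] ℝ}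
    (hd : ∀ x ∈ Ω ∩ U, HasFDerivAt ρ (ρ' x) x) {a : E} (ha : a ≠ 0) {ε : ℝ}
    (hε : ∀ x ∈ Ω ∩ U, ‖ρ' x - innerSL ℝ a‖ ≤ ε * ‖a‖) :
    HasInnerCone Ω U (‖a‖⁻¹ • a) ε := by
  have ha' : 0 < ‖a‖ := norm_pos_iff.2 ha
  intro x hx w hw hxw
  have hw' : ε * ‖a‖ * ‖w‖ ≤ ⟪a, w⟫ := by
    rw [real_inner_smul_left, inv_mul_eq_div, le_div_iff₀ ha'] at hw
    linarith
  have hseg : ∀ s ∈ Icc (0 : ℝ) 1, x - s • w ∈ U := by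
    intro s hs
    have := hU hx.2 hxw (sub_nonneg.2 hs.2) hs.1 (by ring)
    convert this using 1
    module
  have hcont : Continuous fun s : ℝ => x - s • w := by fun_prop
  by_contra hnot
  -- The first exit time `b = sInf T` is attained, because `Ω` is open; the exit point lies on the
  -- boundary.
  let T : Set ℝ := {s | s ∈ Icc (0 : ℝ) 1 ∧ x - s • w ∉ Ω}
  have hTne : T.Nonempty := ⟨1, by simp, by simpa using hnot⟩
  have hTc : IsClosed T :=
    isClosed_Icc.inter ((hΩ.isClosed_compl).preimage hcont)
  have hTb : BddBelow T := ⟨0, fun s hs => hs.1.1⟩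
  set b := sInf T
  have hb : b ∈ T := hTc.csInf_mem hTne hTb
  have hlt : ∀ s ∈ Ico 0 b, x - s • w ∈ Ω := by
    intro s hs
    by_contra h
    exact absurd (csInf_le hTb (show s ∈ T from ⟨⟨hs.1, hs.2.le.trans hb.1.2⟩, h⟩))
      (not_le.2 hs.2)
  have hb0 : 0 < b := by
    rcases hb.1.1.eq_or_lt with h | h
    · exact absurd hx.1 (by have := hb.2; rwa [← h, zero_smul, sub_zero] at this)
    · exact h
  have hcl : x - b • w ∈ closure Ω := by
    have ht : Tendsto (fun s : ℝ => x - s • w) (𝓝[<] b) (𝓝 (x - b • w)) :=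
      hcont.continuousAt.tendsto.mono_left nhdsWithin_le_nhds
    refine mem_closure_of_tendsto ht ?_
    filter_upwards [Ioo_mem_nhdsLT hb0] with s hs using hlt s ⟨hs.1.le, hs.2⟩
  have hfr : x - b • w ∈ frontier Ω := by
    rw [hΩ.frontier_eq]; exact ⟨hcl, hb.2⟩
  have hcl' : ∀ s ∈ Icc 0 b, x - s • w ∈ closure Ω := by
    intro s hs
    rcases hs.2.eq_or_lt with rfl | h
    · exact hcl
    · exact subset_closure (hlt s ⟨hs.1, h⟩)
  -- Before time `b` the path is in `Ω ∩ U`, where `ρ' w ≥ ⟪a, w⟫ - ε ‖a‖ ‖w‖ ≥ 0`. So `ρ` cannot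
  -- rise from its negative value at `x` to `0` at the exit point.
  have hanti : AntitoneOn (fun s : ℝ => ρ (x - s • w)) (Icc 0 b) := by
    have hderiv : ∀ s ∈ Ioo 0 b,
        HasDerivAt (fun s : ℝ => ρ (x - s • w)) (ρ' (x - s • w) (-w)) s := by
      intro s hs
      have h1 : HasDerivAt (fun s : ℝ => x - s • w) (-w) s := by
        simpa using ((hasDerivAt_id s).smul_const w).const_sub x
      exact (hd _ ⟨hlt s ⟨hs.1.le, hs.2⟩,
        hseg s ⟨hs.1.le, hs.2.le.trans hb.1.2⟩⟩).comp_hasDerivAt s h1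
    refine antitoneOn_of_deriv_nonpos (convex_Icc 0 b) ?_ ?_ ?_
    · exact hc.comp hcont.continuousOn hcl'
    · rw [interior_Icc]
      exact fun s hs => (hderiv s hs).differentiableAt.differentiableWithinAt
    · rw [interior_Icc]
      intro s hs
      rw [(hderiv s hs).deriv, map_neg, neg_nonpos]
      have hmem : x - s • w ∈ Ω ∩ U :=
        ⟨hlt s ⟨hs.1.le, hs.2⟩, hseg s ⟨hs.1.le, hs.2.le.trans hb.1.2⟩⟩
      have h1 : |(ρ' (x - s • w) - innerSL ℝ a) w| ≤ ε * ‖a‖ * ‖w‖ :=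
        ((ρ' (x - s • w) - innerSL ℝ a).le_opNorm w).trans
          (mul_le_mul_of_nonneg_right (hε _ hmem) (norm_nonneg w))
      have h2 : (ρ' (x - s • w) - innerSL ℝ a) w = ρ' (x - s • w) w - ⟪a, w⟫ := by simp
      rw [h2] at h1
      linarith [(abs_le.1 h1).1]
  have h1 := hanti (left_mem_Icc.2 hb0.le) (right_mem_Icc.2 hb0.le) hb0.le
  simp only [zero_smul, sub_zero] at h1
  rw [hzero _ hfr] at h1
  linarith [hneg x hx.1]

end Cone

/-! ### Domains with a `C¹` defining function -/

section Domain

variable {E : Type*} [NormedAddCommGroup E] [InnerProductSpace ℝ E] [CompleteSpace E]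

/-- A domain with a `C¹` defining function has unique derivatives up to the boundary. -/
theorem uniqueDiffOn_closure_of_defining {Ω : Set E} (hΩ : IsOpen Ω) {ρ : E → ℝ}
    (hρ : ContDiffOn ℝ 1 ρ (closure Ω)) (hneg : ∀ x ∈ Ω, ρ x < 0)
    (hzero : ∀ x ∈ frontier Ω, ρ x = 0)
    (hgrad : ∀ x ∈ frontier Ω, fderivWithin ℝ ρ (closure Ω) x ≠ 0) :
    UniqueDiffOn ℝ (closure Ω) := by
  intro x hx
  by_cases hxΩ : x ∈ Ω
  · exact uniqueDiffWithinAt_of_mem_nhds (mem_of_superset (hΩ.mem_nhds hxΩ) subset_closure)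
  have hxf : x ∈ frontier Ω := by rw [hΩ.frontier_eq]; exact ⟨hx, hxΩ⟩
  -- Continuity of `fderivWithin` presupposes the uniqueness to be proved, so a continuous
  -- derivative `f'` is taken from the definition of `ContDiffWithinAt` instead.
  obtain ⟨u, hu, -, -, f', hf', hcf⟩ :=
    (contDiffWithinAt_succ_iff_hasFDerivWithinAt' (n := 0) (by simp)).1 (by simpa using hρ x hx)
  rw [insert_eq_of_mem hx] at hu
  have hxu : x ∈ u := mem_of_mem_nhdsWithin hx hu
  -- When `0` is a derivative within the set, `fderivWithin` is `0` by definition; this transfers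
  -- the nonvanishing to `f'` without uniqueness.
  have hne : f' x ≠ 0 := by
    intro h0
    refine hgrad x hxf ?_
    have := hf' x hxu
    rw [h0] at this
    rw [fderivWithin, if_pos this]
  set a : E := (InnerProductSpace.toDual ℝ E).symm (f' x)
  have haf : innerSL ℝ a = f' x := (InnerProductSpace.toDual ℝ E).apply_symm_apply (f' x)
  have ha : a ≠ 0 := by
    rintro h0
    exact hne (by rw [← haf, h0, map_zero])
  have ha' : 0 < ‖a‖ := norm_pos_iff.2 ha
  have hcont := hcf.continuousWithinAt
  have hev : ∀ᶠ y in 𝓝[closure Ω] x, y ∈ u ∧ ‖f' y - f' x‖ < 1 / 2 * ‖a‖ := by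
    refine (show ∀ᶠ y in 𝓝[closure Ω] x, y ∈ u from hu).and ?_
    have h2 := (Metric.tendsto_nhds.1 hcont.tendsto) (1 / 2 * ‖a‖) (by positivity)
    simpa [dist_eq_norm] using h2
  obtain ⟨r, hr, hball⟩ := Metric.mem_nhdsWithin_iff.1 hev
  have hcone : HasInnerCone Ω (Metric.ball x r) (‖a‖⁻¹ • a) (1 / 2) := by
    refine hasInnerCone_of_norm_fderiv_sub_le (ρ' := f') hΩ (convex_ball x r) hρ.continuousOn hneg
      hzero ?_ ha ?_
    · intro y hy
      exact (hf' y (hball ⟨hy.2, subset_closure hy.1⟩).1).hasFDerivAt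
        (mem_of_superset (hΩ.mem_nhds hy.1) subset_closure)
    · intro y hy
      rw [haf]
      exact (hball ⟨hy.2, subset_closure hy.1⟩).2.le
  refine hcone.uniqueDiffWithinAt_closure Metric.isOpen_ball ?_ (by norm_num) (by norm_num) hx
    (Metric.mem_ball_self hr)
  rw [norm_smul, norm_inv, norm_norm, inv_mul_cancel₀ ha'.ne']

/-- The outer unit normal of a domain with defining function `ρ`, at boundary points. -/
def unitNormal (Ω : Set E) (ρ : E → ℝ) (x : E) : E :=
  ‖gradientWithin ρ (closure Ω) x‖⁻¹ • gradientWithin ρ (closure Ω) x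

theorem norm_unitNormal {Ω : Set E} {ρ : E → ℝ} {x : E}
    (h : gradientWithin ρ (closure Ω) x ≠ 0) : ‖unitNormal Ω ρ x‖ = 1 := by
  rw [unitNormal, norm_smul, norm_inv, norm_norm, inv_mul_cancel₀ (norm_ne_zero_iff.2 h)]

theorem continuousOn_gradientWithin {s : Set E} (hs : UniqueDiffOn ℝ s) {ρ : E → ℝ}
    (hρ : ContDiffOn ℝ 1 ρ s) : ContinuousOn (gradientWithin ρ s) s :=
  (InnerProductSpace.toDual ℝ E).symm.continuous.comp_continuousOn
    (hρ.continuousOn_fderivWithin hs le_rfl)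

theorem continuousOn_unitNormal {Ω : Set E} {ρ : E → ℝ} (hs : UniqueDiffOn ℝ (closure Ω))
    (hρ : ContDiffOn ℝ 1 ρ (closure Ω))
    (hgrad : ∀ x ∈ frontier Ω, gradientWithin ρ (closure Ω) x ≠ 0) :
    ContinuousOn (unitNormal Ω ρ) (frontier Ω) := by
  have h := (continuousOn_gradientWithin hs hρ).mono (frontier_subset_closure (s := Ω))
  exact (h.norm.inv₀ fun x hx => norm_ne_zero_iff.2 (hgrad x hx)).smul h

/-- By continuity of the gradient up to the boundary, any aperture defect `ε` is available on a
small enough ball, on which the normal also varies by at most `ε`. -/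
theorem exists_ball_hasInnerCone {Ω : Set E} (hΩ : IsOpen Ω) {ρ : E → ℝ}
    (hs : UniqueDiffOn ℝ (closure Ω))
    (hρ : ContDiffOn ℝ 1 ρ (closure Ω)) (hneg : ∀ x ∈ Ω, ρ x < 0)
    (hzero : ∀ x ∈ frontier Ω, ρ x = 0)
    (hgrad : ∀ x ∈ frontier Ω, gradientWithin ρ (closure Ω) x ≠ 0) {x : E} (hx : x ∈ frontier Ω)
    {ε : ℝ} (hε : 0 < ε) :
    ∃ r > 0, HasInnerCone Ω (Metric.ball x r) (unitNormal Ω ρ x) ε ∧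
      ∀ y ∈ frontier Ω ∩ Metric.ball x r, ‖unitNormal Ω ρ y - unitNormal Ω ρ x‖ ≤ ε := by
  have hxc := frontier_subset_closure hx
  have ha := hgrad x hx
  set a := gradientWithin ρ (closure Ω) x with hadef
  have ha' : 0 < ‖a‖ := norm_pos_iff.2 ha
  have haf : innerSL ℝ a = fderivWithin ℝ ρ (closure Ω) x := by
    rw [← toDual_gradientWithin]; rfl
  have h1 : ∀ᶠ y in 𝓝[closure Ω] x,
      ‖fderivWithin ℝ ρ (closure Ω) y - innerSL ℝ a‖ < ε * ‖a‖ := by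
    rw [haf]
    have h2 := Metric.tendsto_nhds.1 (hρ.continuousOn_fderivWithin hs le_rfl x hxc).tendsto
      (ε * ‖a‖) (by positivity)
    simpa [dist_eq_norm] using h2
  have h3 : ∀ᶠ y in 𝓝[frontier Ω] x, ‖unitNormal Ω ρ y - unitNormal Ω ρ x‖ < ε := by
    have h2 := Metric.tendsto_nhds.1 (continuousOn_unitNormal hs hρ hgrad x hx).tendsto ε hε
    simpa [dist_eq_norm] using h2
  obtain ⟨r₁, hr₁, hb₁⟩ := Metric.mem_nhdsWithin_iff.1 h1
  obtain ⟨r₂, hr₂, hb₂⟩ := Metric.mem_nhdsWithin_iff.1 h3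
  refine ⟨min r₁ r₂, lt_min hr₁ hr₂, ?_, ?_⟩
  · refine hasInnerCone_of_norm_fderiv_sub_le (ρ' := fderivWithin ℝ ρ (closure Ω)) hΩ
      (convex_ball _ _) hρ.continuousOn hneg hzero ?_ ha ?_
    · intro y hy
      exact ((hρ.differentiableOn one_ne_zero) y (subset_closure hy.1)).hasFDerivWithinAt.hasFDerivAt
        (mem_of_superset (hΩ.mem_nhds hy.1) subset_closure)
    · intro y hy
      exact (hb₁ ⟨Metric.ball_subset_ball (min_le_left _ _) hy.2, subset_closure hy.1⟩).le
  · intro y hy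
    exact (hb₂ ⟨Metric.ball_subset_ball (min_le_right _ _) hy.2, hy.1⟩).le

end Domain

/-! ### Derivatives integrated along lines -/

section Fiber

variable {E : Type*} [NormedAddCommGroup E] [InnerProductSpace ℝ E]

/-- Extending a function by zero outside `closure Ω` keeps it differentiable off the part of the
boundary where it may be nonzero. -/
theorem hasFDerivAt_indicator_closure {Ω K : Set E} (hΩ : IsOpen Ω) (hK : IsClosed K) {φ : E → ℝ}
    (hφ : DifferentiableOn ℝ φ (closure Ω)) (hφK : ∀ x ∈ closure Ω, x ∉ K → φ x = 0) {x : E}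
    (hx : x ∉ frontier Ω ∩ K) :
    HasFDerivAt ((closure Ω).indicator φ)
      (Ω.indicator (fderivWithin ℝ φ (closure Ω)) x) x := by
  by_cases hxΩ : x ∈ Ω
  · rw [indicator_of_mem hxΩ]
    have hn : closure Ω ∈ 𝓝 x := mem_of_superset (hΩ.mem_nhds hxΩ) subset_closure
    refine ((hφ x (subset_closure hxΩ)).hasFDerivWithinAt.hasFDerivAt hn).congr_of_eventuallyEq ?_
    filter_upwards [hn] with y hy using indicator_of_mem hy φ
  rw [indicator_of_notMem hxΩ]
  have h0 : (closure Ω).indicator φ =ᶠ[𝓝 x] fun _ => 0 := by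
    by_cases hxc : x ∈ closure Ω
    · have hxK : x ∉ K := fun h => hx ⟨by rw [hΩ.frontier_eq]; exact ⟨hxc, hxΩ⟩, h⟩
      filter_upwards [hK.isOpen_compl.mem_nhds hxK] with y hy
      by_cases hyc : y ∈ closure Ω
      · rw [indicator_of_mem hyc, hφK y hyc hy]
      · exact indicator_of_notMem hyc φ
    · filter_upwards [isClosed_closure.isOpen_compl.mem_nhds hxc] with y hy
      exact indicator_of_notMem hy φ
  exact (hasFDerivAt_const (0 : ℝ) x).congr_of_eventuallyEq h0

/-- The extension of `φ` by zero vanishes identically near a point off `K`, and derivatives are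
unique. -/
theorem indicator_fderivWithin_eq_zero {Ω K : Set E} (hΩ : IsOpen Ω) (hK : IsClosed K) {φ : E → ℝ}
    (hφ : DifferentiableOn ℝ φ (closure Ω)) (hφK : ∀ x ∈ closure Ω, x ∉ K → φ x = 0) {x : E}
    (hx : x ∉ K) : Ω.indicator (fderivWithin ℝ φ (closure Ω)) x = 0 := by
  have h1 := hasFDerivAt_indicator_closure hΩ hK hφ hφK (x := x) (fun h => hx h.2)
  refine h1.unique ((hasFDerivAt_const (0 : ℝ) x).congr_of_eventuallyEq ?_)
  filter_upwards [hK.isOpen_compl.mem_nhds hx] with y hy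
  by_cases hyc : y ∈ closure Ω
  · rw [indicator_of_mem hyc, hφK y hyc hy]
  · exact indicator_of_notMem hyc φ

theorem exists_forall_line_notMem {K : Set E} (hK : IsCompact K) {w : E} (hw : ‖w‖ = 1) (y : E) :
    ∃ R : ℝ, ∀ t : ℝ, R < |t| → y + t • w ∉ K := by
  obtain ⟨C, hC⟩ := hK.isBounded.exists_norm_le
  refine ⟨C + ‖y‖, fun t ht hmem => ?_⟩
  have h1 := hC _ hmem
  have h2 : ‖t • w‖ ≤ ‖y + t • w‖ + ‖y‖ := by
    simpa using norm_sub_le (y + t • w) y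
  rw [norm_smul, hw, mul_one, Real.norm_eq_abs] at h2
  linarith

theorem hasDerivAt_line (y w : E) (t : ℝ) : HasDerivAt (fun t : ℝ => y + t • w) w t := by
  simpa using ((hasDerivAt_id t).smul_const w).const_add y

/-- The integral of the derivative along a line which does not meet the boundary vanishes. -/
theorem integral_line_eq_zero {Ω K : Set E} (hΩ : IsOpen Ω) (hK : IsCompact K) {φ : E → ℝ}
    (hφ : DifferentiableOn ℝ φ (closure Ω)) (hφK : ∀ x ∈ closure Ω, x ∉ K → φ x = 0)
    {w y : E} (hw : ‖w‖ = 1)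
    (hint : Integrable fun t : ℝ => Ω.indicator (fderivWithin ℝ φ (closure Ω)) (y + t • w) w)
    (hy : ∀ t : ℝ, y + t • w ∉ frontier Ω ∩ K) :
    ∫ t : ℝ, Ω.indicator (fderivWithin ℝ φ (closure Ω)) (y + t • w) w = 0 := by
  obtain ⟨R, hR⟩ := exists_forall_line_notMem hK hw y
  have hd : ∀ t : ℝ, HasDerivAt (fun t : ℝ => (closure Ω).indicator φ (y + t • w))
      (Ω.indicator (fderivWithin ℝ φ (closure Ω)) (y + t • w) w) t := fun t =>
    HasFDerivAt.comp_hasDerivAt (f := fun t : ℝ => y + t • w) t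
      (hasFDerivAt_indicator_closure hΩ hK.isClosed hφ hφK (hy t)) (hasDerivAt_line y w t)
  have h0 : ∀ t : ℝ, R < |t| → (closure Ω).indicator φ (y + t • w) = 0 := by
    intro t ht
    by_cases hc : y + t • w ∈ closure Ω
    · rw [indicator_of_mem hc, hφK _ hc (hR t ht)]
    · exact indicator_of_notMem hc φ
  have hbot : Tendsto (fun t : ℝ => (closure Ω).indicator φ (y + t • w)) atBot (𝓝 0) := by
    refine tendsto_const_nhds.congr' ?_
    filter_upwards [tendsto_abs_atBot_atTop.eventually_gt_atTop R] with t ht using (h0 t ht).symm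
  have htop : Tendsto (fun t : ℝ => (closure Ω).indicator φ (y + t • w)) atTop (𝓝 0) := by
    refine tendsto_const_nhds.congr' ?_
    filter_upwards [tendsto_abs_atTop_atTop.eventually_gt_atTop R] with t ht using (h0 t ht).symm
  simpa using integral_of_hasDerivAt_of_tendsto hd hint hbot htop

/-- The integral of the derivative along a line which leaves `Ω` through the boundary point
`x` is the value at `x`. -/
theorem integral_line_eq {Ω U K : Set E} (hΩ : IsOpen Ω) (hU : IsOpen U) (hK : IsCompact K)
    (hKU : K ⊆ U) {φ : E → ℝ} (hφ : DifferentiableOn ℝ φ (closure Ω))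
    (hφK : ∀ x ∈ closure Ω, x ∉ K → φ x = 0) {n : E} {ε : ℝ} (hc : HasInnerCone Ω U n ε)
    {w : E} (hw : ‖w‖ = 1) (hwn : ε < ⟪n, w⟫) {y : E}
    (hint : Integrable fun t : ℝ => Ω.indicator (fderivWithin ℝ φ (closure Ω)) (y + t • w) w)
    {b : ℝ} (hb : y + b • w ∈ frontier Ω ∩ K) :
    ∫ t : ℝ, Ω.indicator (fderivWithin ℝ φ (closure Ω)) (y + t • w) w = φ (y + b • w) := by
  obtain ⟨R, hR⟩ := exists_forall_line_notMem hK hw y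
  have hbU := hKU hb.2
  have hbc := frontier_subset_closure hb.1
  have hbΩ : y + b • w ∉ Ω := by
    have := hb.1
    rw [hΩ.frontier_eq] at this
    exact this.2
  -- Moving backwards in direction `w` stays in the inner cone because `ε < ⟪n, w⟫`. Hence the line
  -- is outside `Ω ∩ K` after `b` and meets `frontier Ω ∩ K` only at `b`.
  have hmove : ∀ s t : ℝ, t < s → y + s • w ∈ closure Ω → y + s • w ∈ U → y + t • w ∈ U →
      y + t • w ∈ Ω := by
    intro s t hst hs hsU htU
    have e : y + t • w = (y + s • w) - (s - t) • w := by module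
    rw [e] at htU ⊢
    refine hc.sub_mem hU hs hsU ?_ htU
    rw [norm_smul, hw, inner_smul_right, Real.norm_of_nonneg (by linarith), mul_one, mul_comm]
    exact mul_lt_mul_of_pos_left hwn (by linarith)
  have hgt : ∀ t : ℝ, b < t → y + t • w ∉ Ω ∩ K := by
    rintro t ht ⟨h1, h2⟩
    exact hbΩ (hmove t b ht (subset_closure h1) (hKU h2) hbU)
  have hlt : ∀ t : ℝ, t < b → y + t • w ∉ frontier Ω ∩ K := by
    rintro t ht ⟨h1, h2⟩
    have := hmove b t ht hbc hbU (hKU h2)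
    rw [hΩ.frontier_eq] at h1
    exact h1.2 this
  have hg0 : ∀ t : ℝ, b < t →
      Ω.indicator (fderivWithin ℝ φ (closure Ω)) (y + t • w) w = 0 := by
    intro t ht
    by_cases h1 : y + t • w ∈ Ω
    · rw [indicator_fderivWithin_eq_zero hΩ hK.isClosed hφ hφK (fun h2 => hgt t ht ⟨h1, h2⟩)]
      simp
    · rw [indicator_of_notMem h1]; simp
  have hsplit : ∫ t in Iic b, Ω.indicator (fderivWithin ℝ φ (closure Ω)) (y + t • w) w =
      ∫ t : ℝ, Ω.indicator (fderivWithin ℝ φ (closure Ω)) (y + t • w) w :=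
    setIntegral_eq_integral_of_forall_compl_eq_zero fun t ht => hg0 t (not_le.1 ht)
  have hd : ∀ t ∈ Iio b, HasDerivAt (fun t : ℝ => (closure Ω).indicator φ (y + t • w))
      (Ω.indicator (fderivWithin ℝ φ (closure Ω)) (y + t • w) w) t := fun t ht =>
    HasFDerivAt.comp_hasDerivAt (f := fun t : ℝ => y + t • w) t
      (hasFDerivAt_indicator_closure hΩ hK.isClosed hφ hφK (hlt t ht)) (hasDerivAt_line y w t)
  have hbot : Tendsto (fun t : ℝ => (closure Ω).indicator φ (y + t • w)) atBot (𝓝 0) := by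
    refine tendsto_const_nhds.congr' ?_
    filter_upwards [tendsto_abs_atBot_atTop.eventually_gt_atTop R] with t ht
    by_cases hc : y + t • w ∈ closure Ω
    · rw [indicator_of_mem hc, hφK _ hc (hR t ht)]
    · exact (indicator_of_notMem hc φ).symm
  have hcl : ContinuousAt (fun t : ℝ => y + t • w) b := by fun_prop
  -- The extension by zero may jump at `b`; only continuity from the left holds, which suffices for
  -- the fundamental theorem of calculus on `Iic b`.
  have hcont : ContinuousWithinAt (fun t : ℝ => (closure Ω).indicator φ (y + t • w)) (Iic b) b := by
    have hin : ∀ᶠ t in 𝓝[Iic b] b, y + t • w ∈ closure Ω := by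
      have h1 : ∀ᶠ t in 𝓝[Iic b] b, y + t • w ∈ U :=
        nhdsWithin_le_nhds (hcl.eventually (hU.mem_nhds hbU))
      filter_upwards [h1, self_mem_nhdsWithin] with t ht htb
      rcases (show t ≤ b from htb).eq_or_lt with rfl | h
      · exact hbc
      · exact subset_closure (hmove b t h hbc hbU ht)
    have h2 : Tendsto (fun t : ℝ => y + t • w) (𝓝[Iic b] b) (𝓝[closure Ω] (y + b • w)) :=
      tendsto_nhdsWithin_iff.2 ⟨hcl.tendsto.mono_left nhdsWithin_le_nhds, hin⟩
    have h3 : Tendsto (fun t : ℝ => φ (y + t • w)) (𝓝[Iic b] b) (𝓝 (φ (y + b • w))) :=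
      ((hφ _ hbc).continuousWithinAt.tendsto).comp h2
    rw [ContinuousWithinAt, indicator_of_mem hbc]
    refine h3.congr' ?_
    filter_upwards [hin] with t ht using (indicator_of_mem ht φ).symm
  have := integral_Iic_of_hasDerivAt_of_tendsto hcont hd hint.integrableOn hbot
  rw [← hsplit, this, sub_zero, indicator_of_mem hbc]

variable [FiniteDimensional ℝ E] [MeasurableSpace E] [BorelSpace E]

omit [FiniteDimensional ℝ E] in
theorem measurable_indicator_fderivWithin_apply {Ω : Set E} (hΩ : IsOpen Ω)
    {φ : E → ℝ} (hs : UniqueDiffOn ℝ (closure Ω)) (hφ : ContDiffOn ℝ 1 φ (closure Ω)) (w : E) :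
    Measurable fun x => Ω.indicator (fderivWithin ℝ φ (closure Ω)) x w := by
  have h1 : ContinuousOn (fun x => fderivWithin ℝ φ (closure Ω) x w) Ω :=
    ((hφ.continuousOn_fderivWithin hs le_rfl).mono subset_closure).clm_apply continuousOn_const
  have h2 : Measurable (Ω.indicator fun x => fderivWithin ℝ φ (closure Ω) x w) := by
    classical
    rw [← piecewise_eq_indicator]
    exact h1.measurable_piecewise continuousOn_const hΩ.measurableSet
  convert h2 using 2 with x
  by_cases hx : x ∈ Ω <;> simp [hx]

omit [MeasurableSpace E] [BorelSpace E] in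
theorem exists_bound_indicator_fderivWithin_apply {Ω : Set E}
    (hΩb : Bornology.IsBounded Ω) {φ : E → ℝ} (hs : UniqueDiffOn ℝ (closure Ω))
    (hφ : ContDiffOn ℝ 1 φ (closure Ω)) (w : E) :
    ∃ C, ∀ x, ‖Ω.indicator (fderivWithin ℝ φ (closure Ω)) x w‖ ≤ C := by
  have h1 : ContinuousOn (fun x => fderivWithin ℝ φ (closure Ω) x w) (closure Ω) :=
    (hφ.continuousOn_fderivWithin hs le_rfl).clm_apply continuousOn_const
  obtain ⟨C, hC⟩ := hΩb.isCompact_closure.exists_bound_of_continuousOn h1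
  refine ⟨max C 0, fun x => ?_⟩
  by_cases hx : x ∈ Ω
  · rw [indicator_of_mem hx]
    exact (hC x (subset_closure hx)).trans (le_max_left _ _)
  · rw [indicator_of_notMem hx]
    simp

theorem integrable_line_indicator_fderivWithin {Ω : Set E} (hΩ : IsOpen Ω)
    (hΩb : Bornology.IsBounded Ω) {φ : E → ℝ} (hs : UniqueDiffOn ℝ (closure Ω))
    (hφ : ContDiffOn ℝ 1 φ (closure Ω)) {w : E} (hw : ‖w‖ = 1) (y : E) :
    Integrable fun t : ℝ => Ω.indicator (fderivWithin ℝ φ (closure Ω)) (y + t • w) w := by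
  obtain ⟨C, hC⟩ := exists_bound_indicator_fderivWithin_apply hΩb hs hφ w
  obtain ⟨R, hR⟩ := exists_forall_line_notMem hΩb.isCompact_closure hw y
  have hline : Measurable fun t : ℝ => y + t • w := by fun_prop
  have hm := (measurable_indicator_fderivWithin_apply hΩ hs hφ w).comp hline
  have h1 : IntegrableOn (fun t : ℝ => Ω.indicator (fderivWithin ℝ φ (closure Ω)) (y + t • w) w)
      (Icc (-R) R) :=
    Measure.integrableOn_of_bounded (M := C) (by simp) hm.aestronglyMeasurable
      (ae_of_all _ fun t => hC _)
  refine (integrableOn_iff_integrable_of_support_subset fun t ht => ?_).1 h1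
  by_contra hcon
  refine ht ?_
  have hlt : R < |t| := by
    by_contra! h
    exact hcon (abs_le.1 h)
  beta_reduce
  rw [indicator_of_notMem fun h => hR t hlt (subset_closure h)]
  simp

theorem integrable_indicator_fderivWithin_apply {Ω : Set E} (hΩ : IsOpen Ω)
    (hΩb : Bornology.IsBounded Ω) {φ : E → ℝ} (hs : UniqueDiffOn ℝ (closure Ω))
    (hφ : ContDiffOn ℝ 1 φ (closure Ω)) (w : E) :
    Integrable fun x => Ω.indicator (fderivWithin ℝ φ (closure Ω)) x w := by
  obtain ⟨C, hC⟩ := exists_bound_indicator_fderivWithin_apply hΩb hs hφ w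
  have hm := measurable_indicator_fderivWithin_apply hΩ hs hφ w
  have h1 : IntegrableOn (fun x => Ω.indicator (fderivWithin ℝ φ (closure Ω)) x w) Ω :=
    Measure.integrableOn_of_bounded (M := C) hΩb.measure_lt_top.ne hm.aestronglyMeasurable
      (ae_of_all _ fun t => hC _)
  refine (integrableOn_iff_integrable_of_support_subset fun x hx => ?_).1 h1
  by_contra hcon
  exact hx (by beta_reduce; rw [indicator_of_notMem hcon]; simp)

theorem setIntegral_fderivWithin_eq_integral_indicator {Ω : Set E} (hΩ : IsOpen Ω)
    (φ : E → ℝ) (w : E) :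
    ∫ x in Ω, fderivWithin ℝ φ (closure Ω) x w =
      ∫ x, Ω.indicator (fderivWithin ℝ φ (closure Ω)) x w := by
  rw [← integral_indicator hΩ.measurableSet]
  congr 1 with x
  by_cases hx : x ∈ Ω <;> simp [hx]

/-- The integral of a directional derivative as an iterated integral over the lines of that
direction. -/
theorem integrable_and_setIntegral_fderivWithin_eq {Ω : Set E} (hΩ : IsOpen Ω)
    (hΩb : Bornology.IsBounded Ω) {φ : E → ℝ} (hs : UniqueDiffOn ℝ (closure Ω))
    (hφ : ContDiffOn ℝ 1 φ (closure Ω)) {w : E} (hw : ‖w‖ = 1) :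
    Integrable (fun y : (ℝ ∙ w)ᗮ =>
        ∫ t : ℝ, Ω.indicator (fderivWithin ℝ φ (closure Ω)) ((y : E) + t • w) w) ∧
      ∫ x in Ω, fderivWithin ℝ φ (closure Ω) x w =
        ∫ y : (ℝ ∙ w)ᗮ, ∫ t : ℝ,
          Ω.indicator (fderivWithin ℝ φ (closure Ω)) ((y : E) + t • w) w := by
  obtain ⟨e, he, heq⟩ := exists_measurePreserving_orthogonal_add_smul hw
  have hint := integrable_indicator_fderivWithin_apply hΩ hΩb hs hφ w
  have hint2 : Integrable (fun q : (ℝ ∙ w)ᗮ × ℝ =>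
      Ω.indicator (fderivWithin ℝ φ (closure Ω)) ((q.1 : E) + q.2 • w) w)
      ((volume : Measure (ℝ ∙ w)ᗮ).prod volume) := by
    have := (he.integrable_comp_emb e.measurableEmbedding).2 hint
    refine this.congr (ae_of_all _ fun q => ?_)
    simp only [Function.comp, heq]
  refine ⟨hint2.integral_prod_left, ?_⟩
  rw [setIntegral_fderivWithin_eq_integral_indicator hΩ,
    ← he.integral_comp e.measurableEmbedding]
  simp only [heq]
  exact integral_prod _ hint2

end Fiber

/-! ### The local divergence estimate -/

section LocalEstimate

variable {E : Type*} [NormedAddCommGroup E] [InnerProductSpace ℝ E]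

/-- If a linear functional is bounded by `I` on unit vectors in a cone around `n` and nearly
attains this bound at `n`, then it is nearly equal to `I ⟪n, ·⟫`. -/
theorem abs_sub_inner_mul_le {L : E →L[ℝ] ℝ} {n : E} (hn : ‖n‖ = 1) {I ε s : ℝ} (hI : 0 ≤ I)
    (hε : ε ≤ 1 / 2) (hs : 0 < s) (hs1 : s ≤ 1)
    (h1 : ∀ w : E, ‖w‖ = 1 → ε < ⟪n, w⟫ → L w ≤ I) (h2 : I ≤ (1 + s ^ 2) * L n)
    {τ : E} (hτ : ‖τ‖ ≤ 1) : |L τ - ⟪n, τ⟫ * I| ≤ 3 * s * I := by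
  have hnn : ⟪n, n⟫ = 1 := by rw [real_inner_self_eq_norm_sq, hn]; norm_num
  have hup : L n ≤ I := h1 n hn (by rw [hnn]; linarith)
  have hlow : (1 - s ^ 2) * I ≤ L n := by nlinarith [sq_nonneg s]
  -- Test the bound on `w = n + s • z` normalised. Then `L n + s L z ≤ ‖w‖ I ≤ (1 + s² / 2) I` and
  -- `L n ≥ (1 - s²) I`, so `s L z ≤ (3 / 2) s² I`. The normalised vector is admissible since `1 /
  -- ‖w‖ > 1 / 2 ≥ ε`.
  have key : ∀ z : E, ⟪n, z⟫ = 0 → ‖z‖ ≤ 1 → L z ≤ 3 / 2 * s * I := by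
    intro z hz hz1
    set w := n + s • z with hw
    have hinner : ⟪n, w⟫ = 1 := by
      rw [hw, inner_add_right, inner_smul_right, hz, hnn]; ring
    have hsq : ‖w‖ ^ 2 = 1 + s ^ 2 * ‖z‖ ^ 2 := by
      rw [hw, norm_add_sq_real, inner_smul_right, hz, hn, norm_smul, Real.norm_of_nonneg hs.le]
      ring
    have hz2 : ‖z‖ ^ 2 ≤ 1 := by nlinarith [norm_nonneg z]
    have hw_le : ‖w‖ ≤ 1 + s ^ 2 / 2 := by
      refine abs_le_of_sq_le_sq' ?_ (by positivity) |>.2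
      nlinarith [sq_nonneg s, sq_nonneg (s ^ 2)]
    have hw_ge : 1 ≤ ‖w‖ := by
      refine abs_le_of_sq_le_sq' ?_ (by positivity) |>.2
      nlinarith [sq_nonneg (s * ‖z‖)]
    have hw0 : 0 < ‖w‖ := by linarith
    have hu := h1 (‖w‖⁻¹ • w) (by rw [norm_smul, norm_inv, norm_norm, inv_mul_cancel₀ hw0.ne'])
      (by
        rw [inner_smul_right, hinner, mul_one]
        refine hε.trans_lt ?_
        rw [one_div]
        refine inv_strictAnti₀ hw0 ?_
        nlinarith)
    rw [map_smul, smul_eq_mul, inv_mul_eq_div, div_le_iff₀ hw0] at hu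
    have hLw : L w = L n + s * L z := by simp [hw]
    have h3 : s * L z ≤ s * (3 / 2 * s * I) := by
      nlinarith [mul_le_mul_of_nonneg_left hw_le hI]
    exact le_of_mul_le_mul_left h3 hs
  set c := ⟪n, τ⟫ with hc
  have hc1 : |c| ≤ 1 := by
    refine (abs_real_inner_le_norm n τ).trans ?_
    rw [hn, one_mul]; exact hτ
  set z := τ - c • n with hz
  have hz0 : ⟪n, z⟫ = 0 := by
    rw [hz, inner_sub_right, inner_smul_right, hnn, ← hc]; ring
  have hz1 : ‖z‖ ≤ 1 := by
    have hsum : τ = z + c • n := by rw [hz]; abel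
    have : ‖τ‖ ^ 2 = ‖z‖ ^ 2 + c ^ 2 := by
      rw [hsum, norm_add_sq_real, inner_smul_right, real_inner_comm, hz0, norm_smul, hn,
        Real.norm_eq_abs, mul_one, sq_abs]
      ring
    refine abs_le_of_sq_le_sq' ?_ (by norm_num) |>.2
    nlinarith [norm_nonneg τ, sq_nonneg c]
  have hLz : |L z| ≤ 3 / 2 * s * I := by
    refine abs_le.2 ⟨?_, key z hz0 hz1⟩
    have := key (-z) (by rw [inner_neg_right, hz0, neg_zero]) (by rwa [norm_neg])
    rw [map_neg] at this
    linarith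
  -- The first summand contributes at most `s I` and the second at most `(3 / 2) s I`.
  have hdec : L τ - c * I = c * (L n - I) + L z := by
    rw [hz, map_sub, map_smul, smul_eq_mul]; ring
  have hLn : |L n - I| ≤ s * I := by
    refine abs_le.2 ⟨?_, ?_⟩
    · have : s ^ 2 * I ≤ s * I := mul_le_mul_of_nonneg_right (by nlinarith) hI
      linarith
    · have : 0 ≤ s * I := by positivity
      linarith
  rw [hdec]
  refine (abs_add_le _ _).trans ?_
  rw [abs_mul]
  have h5 : |c| * |L n - I| ≤ 1 * (s * I) :=
    mul_le_mul hc1 hLn (abs_nonneg _) zero_le_one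
  have h6 : 0 ≤ s * I := by positivity
  linarith

variable [FiniteDimensional ℝ E] [MeasurableSpace E] [BorelSpace E] {d : ℕ}

omit [MeasurableSpace E] [BorelSpace E] in
theorem isCompact_frontier_of_isBounded {Ω : Set E} (hΩb : Bornology.IsBounded Ω) :
    IsCompact (frontier Ω) :=
  hΩb.isCompact_closure.of_isClosed_subset isClosed_frontier frontier_subset_closure

/-- Up to a constant factor the area is bounded by that of the projection along `n`, a compact
subset of the hyperplane. -/
theorem HasInnerCone.euclideanHausdorffMeasure_frontier_lt_top
    (hd : Module.finrank ℝ E = d + 1) {Ω U K : Set E} (hΩ : IsOpen Ω) (hU : IsOpen U)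
    (hK : IsCompact K) (hKU : K ⊆ U) {n : E} (hn : ‖n‖ = 1) {ε : ℝ} (hε : ε < 1)
    (hc : HasInnerCone Ω U n ε) :
    Measure.euclideanHausdorffMeasure d (frontier Ω ∩ K) < ⊤ := by
  set P := (ℝ ∙ n)ᗮ.orthogonalProjectionOnto
  have h1 := map_projection_restrict_le hd hn hε (A := frontier Ω ∩ K) fun x hx y hy =>
    hc.abs_inner_frontier_le hΩ hU ⟨hx.1, hKU hx.2⟩ ⟨hy.1, hKU hy.2⟩
  have h2 := h1 univ
  rw [Measure.map_apply P.continuous.measurable MeasurableSet.univ, preimage_univ,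
    Measure.restrict_apply_univ, Measure.smul_apply, Measure.restrict_apply_univ] at h2
  refine h2.trans_lt (ENNReal.mul_lt_top (ENNReal.pow_lt_top ENNReal.ofReal_lt_top) ?_)
  exact ((hK.inter_left isClosed_frontier).image P.continuous).measure_lt_top

/-- Boundary data for the fibres in direction `w`: the integral of `∂_w φ` over the fibre through
a boundary point is the value of `φ` there. -/
theorem HasInnerCone.integral_line_projection {Ω U K : Set E} (hΩ : IsOpen Ω)
    (hΩb : Bornology.IsBounded Ω) (hU : IsOpen U) (hK : IsCompact K) (hKU : K ⊆ U) {φ : E → ℝ}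
    (hs : UniqueDiffOn ℝ (closure Ω)) (hφ : ContDiffOn ℝ 1 φ (closure Ω))
    (hφK : ∀ x ∈ closure Ω, x ∉ K → φ x = 0) {n : E} {ε : ℝ} (hc : HasInnerCone Ω U n ε)
    {w : E} (hw : ‖w‖ = 1) (hwn : ε < ⟪n, w⟫) :
    (∀ x ∈ frontier Ω ∩ K, ∫ t : ℝ, Ω.indicator (fderivWithin ℝ φ (closure Ω))
      (((ℝ ∙ w)ᗮ.orthogonalProjectionOnto x : E) + t • w) w = φ x) ∧
    ∀ y : (ℝ ∙ w)ᗮ, y ∉ (ℝ ∙ w)ᗮ.orthogonalProjectionOnto '' (frontier Ω ∩ K) →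
      ∫ t : ℝ, Ω.indicator (fderivWithin ℝ φ (closure Ω)) ((y : E) + t • w) w = 0 := by
  constructor
  · intro x hx
    have e := orthogonalProjectionOnto_orthogonal_add_smul hw x
    have := integral_line_eq hΩ hU hK hKU (hφ.differentiableOn one_ne_zero) hφK hc hw hwn
      (integrable_line_indicator_fderivWithin hΩ hΩb hs hφ hw _) (b := ⟪w, x⟫) (by rwa [e])
    rw [this, e]
  · intro y hy
    refine integral_line_eq_zero hΩ hK (hφ.differentiableOn one_ne_zero) hφK hw
      (integrable_line_indicator_fderivWithin hΩ hΩb hs hφ hw _) fun t ht => hy ⟨_, ht, ?_⟩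
    ext
    have e := orthogonalProjectionOnto_orthogonal_add_smul hw ((y : E) + t • w)
    have hyw : ⟪w, (y : E)⟫ = 0 :=
      (Submodule.mem_orthogonal_singleton_iff_inner_right).1 y.2
    have hww : ⟪w, w⟫ = 1 := by rw [real_inner_self_eq_norm_sq, hw]; norm_num
    rw [inner_add_right, inner_smul_right, hyw, hww, zero_add, mul_one] at e
    exact add_right_cancel e

theorem ContinuousOn.integrableOn_frontier {Ω : Set E} (hΩb : Bornology.IsBounded Ω)
    {φ : E → ℝ} (hφ : ContinuousOn φ (frontier Ω)) {μ : Measure E}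
    (hfin : μ (frontier Ω) < ⊤) : IntegrableOn φ (frontier Ω) μ := by
  obtain ⟨C, hC⟩ := (isCompact_frontier_of_isBounded hΩb).exists_bound_of_continuousOn hφ
  exact IntegrableOn.of_bound hfin
    (hφ.aestronglyMeasurable isClosed_frontier.measurableSet) C
    ((ae_restrict_iff' isClosed_frontier.measurableSet).2 (ae_of_all _ hC))

/-- The local form of the divergence theorem, as a pair of inequalities. -/
theorem HasInnerCone.setIntegral_fderivWithin_le_and_le (hd : Module.finrank ℝ E = d + 1)
    {Ω U K : Set E} (hΩ : IsOpen Ω)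
    (hΩb : Bornology.IsBounded Ω) (hU : IsOpen U) (hK : IsCompact K) (hKU : K ⊆ U) {φ : E → ℝ}
    (hs : UniqueDiffOn ℝ (closure Ω)) (hφ : ContDiffOn ℝ 1 φ (closure Ω))
    (hφK : ∀ x ∈ closure Ω, x ∉ K → φ x = 0) (hφ0 : ∀ x ∈ closure Ω, 0 ≤ φ x)
    {n : E} (hn : ‖n‖ = 1) {ε : ℝ} (hε1 : ε < 1) (hc : HasInnerCone Ω U n ε) :
    (∀ w : E, ‖w‖ = 1 → ε < ⟪n, w⟫ → ∫ x in Ω, fderivWithin ℝ φ (closure Ω) x w ≤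
      ∫ x in frontier Ω, φ x ∂(Measure.euclideanHausdorffMeasure d)) ∧
    ∫ x in frontier Ω, φ x ∂(Measure.euclideanHausdorffMeasure d) ≤
      (1 - ε)⁻¹ ^ d * ∫ x in Ω, fderivWithin ℝ φ (closure Ω) x n := by
  set μ : Measure E := Measure.euclideanHausdorffMeasure d
  have hΓ : IsCompact (frontier Ω ∩ K) := hK.inter_left isClosed_frontier
  have hΓm := hΓ.isClosed.measurableSet
  have hφΓ : ContinuousOn φ (frontier Ω ∩ K) :=
    hφ.continuousOn.mono (inter_subset_left.trans frontier_subset_closure)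
  have hΓφ0 : ∀ x ∈ frontier Ω ∩ K, 0 ≤ φ x := fun x hx => hφ0 x (frontier_subset_closure hx.1)
  have hfin := hc.euclideanHausdorffMeasure_frontier_lt_top hd hΩ hU hK hKU hn hε1
  have hrestrict : ∫ x in frontier Ω, φ x ∂μ = ∫ x in frontier Ω ∩ K, φ x ∂μ := by
    have h0 : ∀ x ∈ frontier Ω \ (frontier Ω ∩ K), φ x = 0 := fun x hx =>
      hφK x (frontier_subset_closure hx.1) fun h => hx.2 ⟨hx.1, h⟩
    exact setIntegral_eq_of_subset_of_forall_sdiff_eq_zero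
      isClosed_frontier.measurableSet inter_subset_left h0
  have hint : IntegrableOn φ (frontier Ω ∩ K) μ := by
    obtain ⟨C, hC⟩ := hΓ.exists_bound_of_continuousOn hφΓ
    exact IntegrableOn.of_bound hfin (hφΓ.aestronglyMeasurable hΓm) C
      ((ae_restrict_iff' hΓm).2 (ae_of_all _ hC))
  have hφae : 0 ≤ᵐ[μ.restrict (frontier Ω ∩ K)] φ :=
    (ae_restrict_iff' hΓm).2 (ae_of_all _ hΓφ0)
  have hIeq : ∫ x in frontier Ω ∩ K, φ x ∂μ =
      (∫⁻ x in frontier Ω ∩ K, ENNReal.ofReal (φ x) ∂μ).toReal :=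
    integral_eq_lintegral_of_nonneg_ae hφae hint.aestronglyMeasurable
  have hIfin : ∫⁻ x in frontier Ω ∩ K, ENNReal.ofReal (φ x) ∂μ ≠ ⊤ := hint.lintegral_lt_top.ne
  -- `ψ y` is the integral of `∂_w φ` over the line through `y`: the value of `φ` at the boundary
  -- crossing, and zero for lines without one.
  have hfib : ∀ w : E, ‖w‖ = 1 → ε < ⟪n, w⟫ →
      ∃ ψ : (ℝ ∙ w)ᗮ → ℝ, Integrable ψ ∧ (∀ y, 0 ≤ ψ y) ∧
        ∫ x in Ω, fderivWithin ℝ φ (closure Ω) x w = (∫⁻ y, ENNReal.ofReal (ψ y)).toReal ∧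
        (∀ x ∈ frontier Ω ∩ K, ψ ((ℝ ∙ w)ᗮ.orthogonalProjectionOnto x) = φ x) ∧
        ∀ y, y ∉ (ℝ ∙ w)ᗮ.orthogonalProjectionOnto '' (frontier Ω ∩ K) → ψ y = 0 := by
    intro w hw hwn
    obtain ⟨hψi, hψe⟩ := integrable_and_setIntegral_fderivWithin_eq hΩ hΩb hs hφ hw
    obtain ⟨h1, h2⟩ := hc.integral_line_projection hΩ hΩb hU hK hKU hs hφ hφK hw hwn
    have hpos : ∀ y : (ℝ ∙ w)ᗮ, 0 ≤
        ∫ t : ℝ, Ω.indicator (fderivWithin ℝ φ (closure Ω)) ((y : E) + t • w) w := by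
      intro y
      by_cases hy : y ∈ (ℝ ∙ w)ᗮ.orthogonalProjectionOnto '' (frontier Ω ∩ K)
      · obtain ⟨x, hx, rfl⟩ := hy
        rw [h1 x hx]
        exact hΓφ0 x hx
      · rw [h2 y hy]
    exact ⟨_, hψi, hpos, by
      rw [hψe, integral_eq_lintegral_of_nonneg_ae (ae_of_all _ hpos) hψi.aestronglyMeasurable],
      h1, h2⟩
  rw [hrestrict]
  constructor
  · intro w hw hwn
    obtain ⟨ψ, hψi, hψ0, hψe, h1, h2⟩ := hfib w hw hwn
    set P := (ℝ ∙ w)ᗮ.orthogonalProjectionOnto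
    rw [hψe, hIeq]
    refine ENNReal.toReal_mono hIfin ?_
    have hPm : MeasurableSet (P '' (frontier Ω ∩ K)) :=
      (hΓ.image P.continuous).isClosed.measurableSet
    calc ∫⁻ y, ENNReal.ofReal (ψ y)
        = ∫⁻ y in P '' (frontier Ω ∩ K), ENNReal.ofReal (ψ y) := by
          rw [← lintegral_indicator hPm]
          congr 1 with y
          by_cases hy : y ∈ P '' (frontier Ω ∩ K)
          · rw [indicator_of_mem hy]
          · rw [indicator_of_notMem hy, h2 y hy, ENNReal.ofReal_zero]
      _ ≤ ∫⁻ y, ENNReal.ofReal (ψ y) ∂((μ.restrict (frontier Ω ∩ K)).map P) :=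
          lintegral_mono' (volume_restrict_image_projection_le_map hd hw _) le_rfl
      _ ≤ ∫⁻ x in frontier Ω ∩ K, ENNReal.ofReal (ψ (P x)) ∂μ := lintegral_map_le _ _
      _ = ∫⁻ x in frontier Ω ∩ K, ENNReal.ofReal (φ x) ∂μ :=
          setLIntegral_congr_fun hΓm fun x hx => by rw [h1 x hx]
  · have hnn : ε < ⟪n, n⟫ := by rw [real_inner_self_eq_norm_sq, hn]; simpa using hε1
    obtain ⟨ψ, hψi, hψ0, hψe, h1, h2⟩ := hfib n hn hnn
    set P := (ℝ ∙ n)ᗮ.orthogonalProjectionOnto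
    have h0 : 0 < 1 - ε := by linarith
    have hmap := map_projection_restrict_le hd hn hε1 (A := frontier Ω ∩ K) fun x hx y hy =>
      hc.abs_inner_frontier_le hΩ hU ⟨hx.1, hKU hx.2⟩ ⟨hy.1, hKU hy.2⟩
    have hmap2 : (μ.restrict (frontier Ω ∩ K)).map P ≤
        (ENNReal.ofReal ((1 - ε)⁻¹) ^ d) • (volume : Measure (ℝ ∙ n)ᗮ) :=
      hmap.trans (by gcongr; exact Measure.restrict_le_self)
    -- `ψ` is only almost everywhere measurable for the volume; absolute continuity carries this
    -- over to the projected surface measure.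
    have hac : (μ.restrict (frontier Ω ∩ K)).map P ≪ (volume : Measure (ℝ ∙ n)ᗮ) :=
      (Measure.absolutelyContinuous_of_le hmap2).trans Measure.smul_absolutelyContinuous
    have hle : ∫⁻ x in frontier Ω ∩ K, ENNReal.ofReal (φ x) ∂μ ≤
        ENNReal.ofReal ((1 - ε)⁻¹) ^ d * ∫⁻ y, ENNReal.ofReal (ψ y) :=
      calc ∫⁻ x in frontier Ω ∩ K, ENNReal.ofReal (φ x) ∂μ
          = ∫⁻ x in frontier Ω ∩ K, ENNReal.ofReal (ψ (P x)) ∂μ :=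
            setLIntegral_congr_fun hΓm fun x hx => by rw [h1 x hx]
        _ = ∫⁻ y, ENNReal.ofReal (ψ y) ∂((μ.restrict (frontier Ω ∩ K)).map P) :=
            (lintegral_map' (hψi.aestronglyMeasurable.aemeasurable.ennreal_ofReal.mono_ac hac)
              P.continuous.measurable.aemeasurable).symm
        _ ≤ ∫⁻ y, ENNReal.ofReal (ψ y) ∂((ENNReal.ofReal ((1 - ε)⁻¹) ^ d) •
              (volume : Measure (ℝ ∙ n)ᗮ)) := lintegral_mono' hmap2 le_rfl
        _ = _ := by rw [lintegral_smul_measure, smul_eq_mul]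
    have hψfin : ∫⁻ y, ENNReal.ofReal (ψ y) ≠ ⊤ := hψi.lintegral_lt_top.ne
    rw [hIeq, hψe]
    refine (ENNReal.toReal_mono (ENNReal.mul_ne_top (ENNReal.pow_ne_top ENNReal.ofReal_ne_top)
      hψfin) hle).trans_eq ?_
    rw [ENNReal.toReal_mul, ENNReal.toReal_pow, ENNReal.toReal_ofReal (by positivity)]

end LocalEstimate

/-! ### The divergence theorem on a `C¹` domain -/

section DivergenceTheorem

variable {E : Type*} [NormedAddCommGroup E] [InnerProductSpace ℝ E]
  [FiniteDimensional ℝ E] [MeasurableSpace E] [BorelSpace E] {d : ℕ}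

/-- A bounded domain with a `C¹` defining function `ρ`. -/
structure IsC1Domain (Ω : Set E) (ρ : E → ℝ) : Prop where
  isOpen : IsOpen Ω
  isBounded : Bornology.IsBounded Ω
  contDiffOn : ContDiffOn ℝ 1 ρ (closure Ω)
  neg : ∀ x ∈ Ω, ρ x < 0
  eq_zero : ∀ x ∈ frontier Ω, ρ x = 0
  grad_ne_zero : ∀ x ∈ frontier Ω, gradientWithin ρ (closure Ω) x ≠ 0

namespace IsC1Domain

variable {Ω : Set E} {ρ : E → ℝ}

omit [MeasurableSpace E] [BorelSpace E] in
theorem uniqueDiffOn (h : IsC1Domain Ω ρ) : UniqueDiffOn ℝ (closure Ω) := by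
  refine uniqueDiffOn_closure_of_defining h.isOpen h.contDiffOn h.neg h.eq_zero fun x hx h0 => ?_
  refine h.grad_ne_zero x hx ?_
  rw [gradientWithin, h0, map_zero]

omit [MeasurableSpace E] [BorelSpace E] in
theorem exists_ball (h : IsC1Domain Ω ρ) {x : E} (hx : x ∈ frontier Ω) {ε : ℝ} (hε : 0 < ε) :
    ∃ r > 0, HasInnerCone Ω (Metric.ball x r) (unitNormal Ω ρ x) ε ∧
      ∀ y ∈ frontier Ω ∩ Metric.ball x r, ‖unitNormal Ω ρ y - unitNormal Ω ρ x‖ ≤ ε :=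
  exists_ball_hasInnerCone h.isOpen h.uniqueDiffOn h.contDiffOn h.neg h.eq_zero h.grad_ne_zero
    hx hε

/-- The boundary has finite area. -/
theorem euclideanHausdorffMeasure_frontier_lt_top (h : IsC1Domain Ω ρ)
    (hd : Module.finrank ℝ E = d + 1) :
    Measure.euclideanHausdorffMeasure d (frontier Ω) < ⊤ := by
  refine (isCompact_frontier_of_isBounded h.isBounded).measure_lt_top_of_nhdsWithin fun x hx => ?_
  obtain ⟨r, hr, hc, -⟩ := h.exists_ball hx (ε := 1 / 2) (by norm_num)
  refine ⟨frontier Ω ∩ Metric.closedBall x (r / 2), ?_, ?_⟩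
  · exact inter_mem self_mem_nhdsWithin
      (nhdsWithin_le_nhds (Metric.closedBall_mem_nhds x (by linarith)))
  · exact hc.euclideanHausdorffMeasure_frontier_lt_top hd h.isOpen Metric.isOpen_ball
      (isCompact_closedBall x (r / 2)) (Metric.closedBall_subset_ball (by linarith))
      (norm_unitNormal (h.grad_ne_zero x hx)) (by norm_num)

theorem integrableOn_fderivWithin (h : IsC1Domain Ω ρ) {φ : E → ℝ}
    (hφ : ContDiffOn ℝ 1 φ (closure Ω)) : IntegrableOn (fderivWithin ℝ φ (closure Ω)) Ω :=
  ((hφ.continuousOn_fderivWithin h.uniqueDiffOn le_rfl).integrableOn_compact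
    h.isBounded.isCompact_closure).mono_set subset_closure

theorem integrableOn_fderivWithin_apply (h : IsC1Domain Ω ρ) {φ : E → ℝ}
    (hφ : ContDiffOn ℝ 1 φ (closure Ω)) (w : E) :
    IntegrableOn (fun x => fderivWithin ℝ φ (closure Ω) x w) Ω :=
  (h.integrableOn_fderivWithin hφ).apply_continuousLinearMap w

theorem integrableOn_frontier (h : IsC1Domain Ω ρ) (hd : Module.finrank ℝ E = d + 1) {φ : E → ℝ}
    (hφ : ContinuousOn φ (frontier Ω)) :
    IntegrableOn φ (frontier Ω) (Measure.euclideanHausdorffMeasure d) :=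
  ContinuousOn.integrableOn_frontier h.isBounded hφ
    (h.euclideanHausdorffMeasure_frontier_lt_top hd)

omit [MeasurableSpace E] [BorelSpace E] in
theorem continuousOn_inner_unitNormal (h : IsC1Domain Ω ρ) (τ : E) :
    ContinuousOn (fun x => ⟪unitNormal Ω ρ x, τ⟫) (frontier Ω) :=
  (continuousOn_unitNormal h.uniqueDiffOn h.contDiffOn h.grad_ne_zero).inner continuousOn_const

/-- The local form of the divergence theorem with a small error. -/
theorem exists_isOpen_abs_sub_le (h : IsC1Domain Ω ρ) (hd : Module.finrank ℝ E = d + 1) {s : ℝ}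
    (hs : 0 < s) (hs1 : s ≤ 1) {x : E} (hx : x ∈ closure Ω) :
    ∃ U : Set E, IsOpen U ∧ x ∈ U ∧ ∀ K : Set E, IsCompact K → K ⊆ U → ∀ φ : E → ℝ,
      ContDiffOn ℝ 1 φ (closure Ω) → (∀ y ∈ closure Ω, y ∉ K → φ y = 0) →
      (∀ y ∈ closure Ω, 0 ≤ φ y) → ∀ τ : E, ‖τ‖ ≤ 1 →
      |(∫ y in Ω, fderivWithin ℝ φ (closure Ω) y τ) -
        ∫ y in frontier Ω, φ y * ⟪unitNormal Ω ρ y, τ⟫ ∂(Measure.euclideanHausdorffMeasure d)| ≤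
      4 * s * ∫ y in frontier Ω, φ y ∂(Measure.euclideanHausdorffMeasure d) := by
  set μ : Measure E := Measure.euclideanHausdorffMeasure d
  have hfm : MeasurableSet (frontier Ω) := isClosed_frontier.measurableSet
  by_cases hxΩ : x ∈ Ω
  -- At interior points both sides vanish: `K` misses the boundary, so every line integral is zero.
  · refine ⟨Ω, h.isOpen, hxΩ, fun K hK hKΩ φ hφ hφK hφ0 τ hτ => ?_⟩
    have hdisj : frontier Ω ∩ K = ∅ := by
      rw [h.isOpen.frontier_eq]
      exact eq_empty_of_forall_notMem fun y hy => hy.1.2 (hKΩ hy.2)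
    have hzero : ∀ y ∈ frontier Ω, φ y = 0 := fun y hy =>
      hφK y (frontier_subset_closure hy) fun hyK => by
        have : y ∈ frontier Ω ∩ K := ⟨hy, hyK⟩
        simp [hdisj] at this
    have h1 : ∫ y in frontier Ω, φ y * ⟪unitNormal Ω ρ y, τ⟫ ∂μ = 0 :=
      setIntegral_eq_zero_of_forall_eq_zero fun y hy => by rw [hzero y hy, zero_mul]
    have h2 : ∫ y in frontier Ω, φ y ∂μ = 0 :=
      setIntegral_eq_zero_of_forall_eq_zero hzero
    have hunit : ∀ w : E, ‖w‖ = 1 → ∫ y in Ω, fderivWithin ℝ φ (closure Ω) y w = 0 := by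
      intro w hw
      rw [(integrable_and_setIntegral_fderivWithin_eq h.isOpen h.isBounded h.uniqueDiffOn hφ hw).2]
      refine integral_eq_zero_of_ae (ae_of_all _ fun y => ?_)
      exact integral_line_eq_zero h.isOpen hK (hφ.differentiableOn one_ne_zero) hφK hw
        (integrable_line_indicator_fderivWithin h.isOpen h.isBounded h.uniqueDiffOn hφ hw _)
        (by simp [hdisj])
    have h3 : ∫ y in Ω, fderivWithin ℝ φ (closure Ω) y τ = 0 := by
      by_cases hτ0 : τ = 0
      · simp [hτ0]
      have h4 : τ = ‖τ‖ • (‖τ‖⁻¹ • τ) := by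
        rw [smul_smul, mul_inv_cancel₀ (norm_ne_zero_iff.2 hτ0), one_smul]
      rw [h4]
      simp_rw [map_smul _ ‖τ‖]
      rw [integral_smul, hunit _ (by
        rw [norm_smul, norm_inv, norm_norm, inv_mul_cancel₀ (norm_ne_zero_iff.2 hτ0)]), smul_zero]
    rw [h1, h2, h3]
    simp
  have hxf : x ∈ frontier Ω := by rw [h.isOpen.frontier_eq]; exact ⟨hx, hxΩ⟩
  -- `ε ≤ s` controls the variation of the normal, `ε ≤ 1 / 2` admits the perturbed directions in
  -- `abs_sub_inner_mul_le`, and the last bound says that projecting along `n` loses at most the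
  -- factor `1 + s²`.
  obtain ⟨ε, hε0, hεs, hε2, hεd⟩ : ∃ ε : ℝ, 0 < ε ∧ ε ≤ s ∧ ε ≤ 1 / 2 ∧
      (1 - ε)⁻¹ ^ d ≤ 1 + s ^ 2 := by
    have hc : ContinuousAt (fun ε : ℝ => (1 - ε)⁻¹ ^ d) 0 :=
      ((continuousAt_const.sub continuousAt_id).inv₀ (by norm_num)).pow d
    have h1 : ∀ᶠ ε in 𝓝 (0 : ℝ), (1 - ε)⁻¹ ^ d < 1 + s ^ 2 :=
      hc.eventually_lt_const (by simp; positivity)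
    have h2 : ∀ᶠ ε in 𝓝[>] (0 : ℝ), 0 < ε ∧ ε ≤ s ∧ ε ≤ 1 / 2 ∧ (1 - ε)⁻¹ ^ d ≤ 1 + s ^ 2 := by
      filter_upwards [nhdsWithin_le_nhds h1, Ioo_mem_nhdsGT hs,
        Ioo_mem_nhdsGT (show (0 : ℝ) < 1 / 2 by norm_num)] with ε ha hb hc
      exact ⟨hb.1, hb.2.le, hc.2.le, ha.le⟩
    exact h2.exists
  obtain ⟨r, hr, hcone, hnorm⟩ := h.exists_ball hxf hε0
  refine ⟨Metric.ball x r, Metric.isOpen_ball, Metric.mem_ball_self hr,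
    fun K hK hKU φ hφ hφK hφ0 τ hτ => ?_⟩
  set n := unitNormal Ω ρ x
  have hn : ‖n‖ = 1 := norm_unitNormal (h.grad_ne_zero x hxf)
  obtain ⟨h1, h2⟩ := hcone.setIntegral_fderivWithin_le_and_le hd h.isOpen h.isBounded
    Metric.isOpen_ball hK hKU h.uniqueDiffOn hφ hφK hφ0 hn (by linarith)
  have hφc : ContinuousOn φ (frontier Ω) := hφ.continuousOn.mono frontier_subset_closure
  have hφi := h.integrableOn_frontier hd hφc
  have hφf0 : ∀ y ∈ frontier Ω, 0 ≤ φ y := fun y hy => hφ0 y (frontier_subset_closure hy)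
  set I := ∫ y in frontier Ω, φ y ∂μ
  have hI : 0 ≤ I := setIntegral_nonneg hfm hφf0
  let L : E →L[ℝ] ℝ := ∫ y in Ω, fderivWithin ℝ φ (closure Ω) y
  have hL : ∀ w, L w = ∫ y in Ω, fderivWithin ℝ φ (closure Ω) y w := fun w =>
    ContinuousLinearMap.integral_apply (h.integrableOn_fderivWithin hφ) w
  have hLn : 0 ≤ L n := by
    by_contra! hneg
    have h0 : 0 < (1 - ε)⁻¹ ^ d := pow_pos (inv_pos.2 (by linarith)) d
    rw [← hL] at h2
    nlinarith [mul_neg_of_pos_of_neg h0 hneg]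
  have hest := abs_sub_inner_mul_le (L := L) hn hI hε2 hs hs1
    (fun w hw hwn => by rw [hL]; exact h1 w hw hwn)
    (by
      rw [← hL] at h2
      exact h2.trans (mul_le_mul_of_nonneg_right hεd hLn)) hτ
  rw [hL] at hest
  -- Replacing the frozen normal `n` by the true one costs another `s * I`; with the `3 * s * I`
  -- from `hest` this makes `4 * s * I`.
  have hvar : |⟪n, τ⟫ * I - ∫ y in frontier Ω, φ y * ⟪unitNormal Ω ρ y, τ⟫ ∂μ| ≤ s * I := by
    have hi2 := h.integrableOn_frontier hd (φ := fun y => φ y * ⟪unitNormal Ω ρ y, τ⟫) (hφc.mul (h.continuousOn_inner_unitNormal τ))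
    have e1 : ⟪n, τ⟫ * I - ∫ y in frontier Ω, φ y * ⟪unitNormal Ω ρ y, τ⟫ ∂μ =
        ∫ y in frontier Ω, (⟪n, τ⟫ * φ y - φ y * ⟪unitNormal Ω ρ y, τ⟫) ∂μ := by
      rw [integral_sub (hφi.const_mul _) hi2, integral_const_mul]
    rw [e1, ← integral_const_mul, ← Real.norm_eq_abs]
    refine norm_integral_le_of_norm_le (hφi.const_mul s)
      ((ae_restrict_iff' hfm).2 (ae_of_all _ fun y hy => ?_))
    by_cases hyK : y ∈ K
    · have e2 : ⟪n, τ⟫ * φ y - φ y * ⟪unitNormal Ω ρ y, τ⟫ =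
          - (⟪unitNormal Ω ρ y - n, τ⟫ * φ y) := by
        rw [inner_sub_left]; ring
      rw [e2, norm_neg, norm_mul, Real.norm_of_nonneg (hφf0 y hy)]
      refine mul_le_mul_of_nonneg_right ?_ (hφf0 y hy)
      calc ‖⟪unitNormal Ω ρ y - n, τ⟫‖ ≤ ‖unitNormal Ω ρ y - n‖ * ‖τ‖ := norm_inner_le_norm _ _
        _ ≤ ε * 1 := mul_le_mul (hnorm y ⟨hy, hKU hyK⟩) hτ (norm_nonneg _) hε0.le
        _ ≤ s := by linarith
    · rw [hφK y (frontier_subset_closure hy) hyK]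
      simp
  have := abs_sub_le (∫ y in Ω, fderivWithin ℝ φ (closure Ω) y τ) (⟪n, τ⟫ * I)
    (∫ y in frontier Ω, φ y * ⟪unitNormal Ω ρ y, τ⟫ ∂μ)
  linarith

open scoped Manifold ContDiff in
omit [MeasurableSpace E] [BorelSpace E] in
/-- A smooth partition of unity on a compact set, subordinate to given open neighbourhoods of its
points. -/
theorem exists_finite_smooth_partition {S : Set E} (hS : IsCompact S) {U : E → Set E}
    (hU : ∀ x ∈ S, IsOpen (U x)) (hxU : ∀ x ∈ S, x ∈ U x) :
    ∃ (t : Finset E) (χ : t → E → ℝ), (∀ i, ContDiff ℝ ∞ (χ i)) ∧ (∀ i x, 0 ≤ χ i x) ∧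
      (∀ x ∈ S, ∑ i, χ i x = 1) ∧ ∀ i : t, (i : E) ∈ S ∧ tsupport (χ i) ⊆ U i := by
  obtain ⟨t, htS, ht⟩ := hS.elim_nhds_subcover U fun x hx => (hU x hx).mem_nhds (hxU x hx)
  obtain ⟨f, hf⟩ := SmoothPartitionOfUnity.exists_isSubordinate 𝓘(ℝ, E) hS.isClosed
    (fun i : t => U i) (fun i => hU i (htS i i.2)) (by simpa [iUnion_subtype] using ht)
  refine ⟨t, fun i => f i, fun i => (f i).contMDiff.contDiff, fun i x => f.nonneg i x,
    fun x hx => ?_, fun i => ⟨htS i i.2, hf i⟩⟩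
  rw [← f.sum_eq_one hx, finsum_eq_sum_of_fintype]

/-- The local errors are proportional to `∫ χ i * φ` over the boundary, so they sum to the same
multiple of `∫ φ`, however many pieces the partition has. -/
theorem abs_setIntegral_fderivWithin_sub_le (h : IsC1Domain Ω ρ) (hd : Module.finrank ℝ E = d + 1)
    {s : ℝ} (hs : 0 < s) (hs1 : s ≤ 1) {φ : E → ℝ} (hφ : ContDiffOn ℝ 1 φ (closure Ω))
    (hφ0 : ∀ y ∈ closure Ω, 0 ≤ φ y) {τ : E} (hτ : ‖τ‖ ≤ 1) :
    |(∫ y in Ω, fderivWithin ℝ φ (closure Ω) y τ) -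
        ∫ y in frontier Ω, φ y * ⟪unitNormal Ω ρ y, τ⟫ ∂(Measure.euclideanHausdorffMeasure d)| ≤
      4 * s * ∫ y in frontier Ω, φ y ∂(Measure.euclideanHausdorffMeasure d) := by
  set μ : Measure E := Measure.euclideanHausdorffMeasure d
  have hfm : MeasurableSet (frontier Ω) := isClosed_frontier.measurableSet
  have hS := h.isBounded.isCompact_closure
  have hex := fun (x : E) (hx : x ∈ closure Ω) => h.exists_isOpen_abs_sub_le hd hs hs1 hx
  choose! U hUo hxU hUest using hex
  obtain ⟨t, χ, hχd, hχ0, hχ1, hχU⟩ := exists_finite_smooth_partition hS hUo hxU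
  have hχφ : ∀ i, ContDiffOn ℝ 1 (fun y => χ i y * φ y) (closure Ω) := fun i =>
    (((hχd i).of_le (by exact_mod_cast le_top)).contDiffOn).mul hφ
  have hloc : ∀ i, |(∫ y in Ω, fderivWithin ℝ (fun y => χ i y * φ y) (closure Ω) y τ) -
        ∫ y in frontier Ω, (χ i y * φ y) * ⟪unitNormal Ω ρ y, τ⟫ ∂μ| ≤
      4 * s * ∫ y in frontier Ω, χ i y * φ y ∂μ := by
    intro i
    refine hUest i (hχU i).1 (closure Ω ∩ tsupport (χ i)) (hS.inter_right (isClosed_tsupport _))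
      (inter_subset_right.trans (hχU i).2) _ (hχφ i) (fun y hy hyK => ?_)
      (fun y hy => mul_nonneg (hχ0 i y) (hφ0 y hy)) τ hτ
    rw [image_eq_zero_of_notMem_tsupport fun hyt => hyK ⟨hy, hyt⟩, zero_mul]
  have hsum : ∀ y ∈ closure Ω, φ y = ∑ i, χ i y * φ y := by
    intro y hy
    rw [← Finset.sum_mul, hχ1 y hy, one_mul]
  have hc : ∀ i, ContinuousOn (fun y => χ i y * φ y) (frontier Ω) := fun i =>
    (hχφ i).continuousOn.mono frontier_subset_closure
  have e1 : ∫ y in Ω, fderivWithin ℝ φ (closure Ω) y τ =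
      ∑ i, ∫ y in Ω, fderivWithin ℝ (fun y => χ i y * φ y) (closure Ω) y τ := by
    rw [← integral_finsetSum _ fun i _ => h.integrableOn_fderivWithin_apply (hχφ i) τ]
    refine setIntegral_congr_fun h.isOpen.measurableSet fun y hy => ?_
    have hyc := subset_closure hy
    rw [fderivWithin_congr hsum (hsum y hyc), fderivWithin_fun_sum (h.uniqueDiffOn y hyc)
      fun i _ => (hχφ i).differentiableOn one_ne_zero y hyc]
    simp
  have e2 : ∫ y in frontier Ω, φ y * ⟪unitNormal Ω ρ y, τ⟫ ∂μ =
      ∑ i, ∫ y in frontier Ω, (χ i y * φ y) * ⟪unitNormal Ω ρ y, τ⟫ ∂μ := by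
    rw [← integral_finsetSum _ fun i _ => h.integrableOn_frontier hd
      (φ := fun y => (χ i y * φ y) * ⟪unitNormal Ω ρ y, τ⟫)
      ((hc i).mul (h.continuousOn_inner_unitNormal τ))]
    refine setIntegral_congr_fun hfm fun y hy => ?_
    rw [← Finset.sum_mul, ← hsum y (frontier_subset_closure hy)]
  have e3 : ∫ y in frontier Ω, φ y ∂μ = ∑ i, ∫ y in frontier Ω, χ i y * φ y ∂μ := by
    rw [← integral_finsetSum _ fun i _ => h.integrableOn_frontier hd (hc i)]
    exact setIntegral_congr_fun hfm fun y hy => hsum y (frontier_subset_closure hy)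
  rw [e1, e2, e3, ← Finset.sum_sub_distrib, Finset.mul_sum]
  exact (Finset.abs_sum_le_sum_abs _ _).trans (Finset.sum_le_sum fun i _ => hloc i)

/-- **Divergence theorem** for a bounded domain with a `C¹` defining function. -/
theorem setIntegral_fderivWithin_eq (h : IsC1Domain Ω ρ) (hd : Module.finrank ℝ E = d + 1)
    {φ : E → ℝ} (hφ : ContDiffOn ℝ 1 φ (closure Ω)) (τ : E) :
    ∫ y in Ω, fderivWithin ℝ φ (closure Ω) y τ =
      ∫ y in frontier Ω, φ y * ⟪unitNormal Ω ρ y, τ⟫ ∂(Measure.euclideanHausdorffMeasure d) := by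
  set μ : Measure E := Measure.euclideanHausdorffMeasure d
  have hunit : ∀ φ : E → ℝ, ContDiffOn ℝ 1 φ (closure Ω) → (∀ y ∈ closure Ω, 0 ≤ φ y) →
      ∀ τ : E, ‖τ‖ ≤ 1 → ∫ y in Ω, fderivWithin ℝ φ (closure Ω) y τ =
        ∫ y in frontier Ω, φ y * ⟪unitNormal Ω ρ y, τ⟫ ∂μ := by
    intro φ hφ hφ0 τ hτ
    rw [← sub_eq_zero, ← abs_nonpos_iff]
    have ht : Tendsto (fun s : ℝ => 4 * s * ∫ y in frontier Ω, φ y ∂μ) (𝓝[>] 0) (𝓝 0) := by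
      have : ContinuousAt (fun s : ℝ => 4 * s * ∫ y in frontier Ω, φ y ∂μ) 0 := by fun_prop
      have h2 := this.tendsto
      simp only [mul_zero, zero_mul] at h2
      exact h2.mono_left nhdsWithin_le_nhds
    refine ge_of_tendsto ht ?_
    filter_upwards [Ioo_mem_nhdsGT (zero_lt_one (α := ℝ))] with s hs
    exact h.abs_setIntegral_fderivWithin_sub_le hd hs.1 hs.2.le hφ hφ0 hτ
  have hnonneg : ∀ φ : E → ℝ, ContDiffOn ℝ 1 φ (closure Ω) → (∀ y ∈ closure Ω, 0 ≤ φ y) →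
      ∫ y in Ω, fderivWithin ℝ φ (closure Ω) y τ =
        ∫ y in frontier Ω, φ y * ⟪unitNormal Ω ρ y, τ⟫ ∂μ := by
    intro φ hφ hφ0
    by_cases hτ0 : τ = 0
    · simp [hτ0]
    have h4 : τ = ‖τ‖ • (‖τ‖⁻¹ • τ) := by
      rw [smul_smul, mul_inv_cancel₀ (norm_ne_zero_iff.2 hτ0), one_smul]
    have h5 := hunit φ hφ hφ0 (‖τ‖⁻¹ • τ) (by
      rw [norm_smul, norm_inv, norm_norm, inv_mul_cancel₀ (norm_ne_zero_iff.2 hτ0)])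
    rw [h4]
    simp_rw [map_smul _ ‖τ‖, inner_smul_right _ _ ‖τ‖, smul_eq_mul, mul_left_comm _ ‖τ‖]
    rw [integral_const_mul, integral_const_mul, h5]
  -- A bounded `φ` becomes nonnegative after adding `|C|`; the nonnegative case for the constant
  -- `|C|` removes it again.
  obtain ⟨C, hC⟩ := h.isBounded.isCompact_closure.exists_bound_of_continuousOn hφ.continuousOn
  have h1 := hnonneg (fun y => φ y + |C|) (hφ.add contDiffOn_const) fun y hy => by
    have := (abs_le.1 (hC y hy)).1
    have := le_abs_self C
    linarith
  have h2 := hnonneg (fun _ => |C|) contDiffOn_const fun _ _ => abs_nonneg C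
  have hci := h.integrableOn_frontier hd (φ := fun y => φ y * ⟪unitNormal Ω ρ y, τ⟫)
    ((hφ.continuousOn.mono frontier_subset_closure).mul (h.continuousOn_inner_unitNormal τ))
  have hcC := h.integrableOn_frontier hd (φ := fun y => |C| * ⟪unitNormal Ω ρ y, τ⟫)
    (continuousOn_const.mul (h.continuousOn_inner_unitNormal τ))
  simp only [fderivWithin_add_const, fderivWithin_fun_const, Pi.zero_apply,
    zero_apply, integral_zero, add_mul] at h1 h2
  rw [integral_add hci hcC, ← h2, add_zero] at h1
  exact h1

end IsC1Domain

end DivergenceTheorem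

/-! ### Octonion algebra in coordinates -/

namespace Octonion

theorem re_fst (x : Octonion) : x.fst.re = x 0 := rfl
theorem imI_fst (x : Octonion) : x.fst.imI = x 1 := rfl
theorem imJ_fst (x : Octonion) : x.fst.imJ = x 2 := rfl
theorem imK_fst (x : Octonion) : x.fst.imK = x 3 := rfl
theorem re_snd (x : Octonion) : x.snd.re = x 4 := rfl
theorem imI_snd (x : Octonion) : x.snd.imI = x 5 := rfl
theorem imJ_snd (x : Octonion) : x.snd.imJ = x 6 := rfl
theorem imK_snd (x : Octonion) : x.snd.imK = x 7 := rfl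

/-- The multiplication table turns the octonion identities below into polynomial identities, checked
coordinatewise. -/
theorem mul_eq (x y : Octonion) : x * y = !₂[
    x 0 * y 0 - x 1 * y 1 - x 2 * y 2 - x 3 * y 3 - x 4 * y 4 - x 5 * y 5 - x 6 * y 6 - x 7 * y 7,
    x 0 * y 1 + x 1 * y 0 + x 2 * y 3 - x 3 * y 2 + x 4 * y 5 - x 5 * y 4 - x 6 * y 7 + x 7 * y 6,
    x 0 * y 2 - x 1 * y 3 + x 2 * y 0 + x 3 * y 1 + x 4 * y 6 + x 5 * y 7 - x 6 * y 4 - x 7 * y 5,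
    x 0 * y 3 + x 1 * y 2 - x 2 * y 1 + x 3 * y 0 + x 4 * y 7 - x 5 * y 6 + x 6 * y 5 - x 7 * y 4,
    x 0 * y 4 - x 1 * y 5 - x 2 * y 6 - x 3 * y 7 + x 4 * y 0 + x 5 * y 1 + x 6 * y 2 + x 7 * y 3,
    x 0 * y 5 + x 1 * y 4 - x 2 * y 7 + x 3 * y 6 - x 4 * y 1 + x 5 * y 0 - x 6 * y 3 + x 7 * y 2,
    x 0 * y 6 + x 1 * y 7 + x 2 * y 4 - x 3 * y 5 - x 4 * y 2 + x 5 * y 3 + x 6 * y 0 - x 7 * y 1,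
    x 0 * y 7 - x 1 * y 6 + x 2 * y 5 + x 3 * y 4 - x 4 * y 3 - x 5 * y 2 + x 6 * y 1 + x 7 * y 0]
    := by
  change mk _ _ = _
  simp only [mk]
  ext i
  fin_cases i <;> simp [re_fst, imI_fst, imJ_fst, imK_fst, re_snd, imI_snd, imJ_snd,
    imK_snd] <;> ring

theorem star_eq (x : Octonion) :
    star x = !₂[x 0, -x 1, -x 2, -x 3, -x 4, -x 5, -x 6, -x 7] := by
  change mk _ _ = _
  simp only [mk]
  ext i
  fin_cases i <;> simp [re_fst, imI_fst, imJ_fst, imK_fst, re_snd, imI_snd, imJ_snd,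
    imK_snd]

theorem re_eq_inner_star (x y : Octonion) : (x * y).re = ⟪x, star y⟫ := by
  simp only [re, mul_eq, star_eq, PiLp.inner_apply, Fin.sum_univ_eight, RCLike.inner_apply,
    conj_trivial]
  simp
  ring

theorem mul_star_re (x y : Octonion) : (x * star y).re = ⟪x, y⟫ := by
  simp only [re, mul_eq, star_eq, PiLp.inner_apply, Fin.sum_univ_eight, RCLike.inner_apply,
    conj_trivial]
  simp
  ring

theorem star_add (x y : Octonion) : star (x + y) = star x + star y := by
  simp only [star_eq]
  ext i
  fin_cases i <;> simp <;> ring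

theorem star_smul (c : ℝ) (x : Octonion) : star (c • x) = c • star x := by
  simp only [star_eq]
  ext i
  fin_cases i <;> simp

theorem conj_conj (x : Octonion) : star (star x) = x := by
  simp only [star_eq]
  ext i
  fin_cases i <;> simp

theorem inner_star_star (x y : Octonion) : ⟪star x, star y⟫ = ⟪x, y⟫ := by
  simp only [star_eq, PiLp.inner_apply, Fin.sum_univ_eight, RCLike.inner_apply, conj_trivial]
  simp

theorem add_mul (x y z : Octonion) : (x + y) * z = x * z + y * z := by
  simp only [mul_eq]
  ext i
  fin_cases i <;> simp <;> ring

theorem mul_add (x y z : Octonion) : x * (y + z) = x * y + x * z := by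
  simp only [mul_eq]
  ext i
  fin_cases i <;> simp <;> ring

theorem smul_mul (c : ℝ) (x y : Octonion) : (c • x) * y = c • (x * y) := by
  simp only [mul_eq]
  ext i
  fin_cases i <;> simp <;> ring

theorem mul_smul (c : ℝ) (x y : Octonion) : x * (c • y) = c • (x * y) := by
  simp only [mul_eq]
  ext i
  fin_cases i <;> simp <;> ring

/-- The trace form is invariant under moving a factor to the other side. -/
theorem inner_mul_left (x y z : Octonion) : ⟪x * y, z⟫ = ⟪y, star x * z⟫ := by
  simp only [mul_eq, star_eq, PiLp.inner_apply, Fin.sum_univ_eight, RCLike.inner_apply,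
    conj_trivial]
  simp
  ring

theorem inner_mul_right (x y z : Octonion) : ⟪x * y, z⟫ = ⟪x, z * star y⟫ := by
  simp only [mul_eq, star_eq, PiLp.inner_apply, Fin.sum_univ_eight, RCLike.inner_apply,
    conj_trivial]
  simp
  ring

theorem inner_e_left (p : Fin 8) (x : Octonion) : ⟪e p, x⟫ = x p := by
  rw [e, EuclideanSpace.inner_single_left]
  simp

theorem sum_smul_e (x : Octonion) : ∑ p, x p • e p = x := by
  ext q
  simp [e, Pi.single_apply]

theorem mul_re_smul_e_zero (x : Octonion) (c : ℝ) : x * (c • e 0) = c • x := by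
  simp only [mul_eq, e]
  ext i
  fin_cases i <;> simp [mul_comm]

theorem conj_mul (x y : Octonion) : star (x * y) = star y * star x := by
  simp only [mul_eq, star_eq]
  ext i
  fin_cases i <;> simp <;> ring

theorem eq_re_smul_of_star_eq {x : Octonion} (h : star x = x) : x = x.re • e 0 := by
  rw [star_eq] at h
  have h1 : ∀ i, _ = x i := fun i => congrArg (fun y : Octonion => y i) h
  have h1' := h1 1
  have h2' := h1 2
  have h3' := h1 3
  have h4' := h1 4
  have h5' := h1 5
  have h6' := h1 6
  have h7' := h1 7
  simp at h1' h2' h3' h4' h5' h6' h7'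
  ext i
  fin_cases i <;> simp [re, e] <;> linarith

/-- Octonionic conjugation as a continuous linear map. -/
def conjL : Octonion →L[ℝ] Octonion :=
  LinearMap.toContinuousLinearMap
    { toFun := fun x => star x
      map_add' := star_add
      map_smul' := star_smul }

/-- Left multiplication as a continuous linear map. -/
def mulLeftL (a : Octonion) : Octonion →L[ℝ] Octonion :=
  LinearMap.toContinuousLinearMap
    { toFun := fun x => a * x
      map_add' := mul_add a
      map_smul' := fun c x => mul_smul c a x }

theorem conjL_apply (x : Octonion) : conjL x = star x := rfl

theorem mulLeftL_apply (a x : Octonion) : mulLeftL a x = a * x := rfl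

end Octonion

namespace Octonion

theorem inner_eq_sum (x y : Octonion) : ⟪x, y⟫ = ∑ p, x p * y p := by
  simp [PiLp.inner_apply, mul_comm]

/-- The matrix of left multiplication by `b`, needed to interchange the two indices of second
derivatives. -/
theorem mul_apply_eq_sum (b x : Octonion) (p : Fin 8) :
    (b * x) p = ∑ q, x q * (b * e q) p := by
  conv_lhs => rw [← mulLeftL_apply, ← sum_smul_e x, map_sum]
  simp [mulLeftL_apply]

end Octonion

/-! ### The flux field and its divergence -/

namespace OctonionMatrix

open Octonion

/-- The vector field `cof(B) ξ / 2`, which represents the linear functional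
`η ↦ det (𝒯 (ξ ⊗ η), B)`. -/
def flux (ξ : Fin 2 → Octonion) (B : OctonionMatrix) : Fin 2 → Octonion :=
  ![(1 / 2 : ℝ) • ((B 1 1).re • ξ 0 - B 0 1 * ξ 1), (1 / 2 : ℝ) • ((B 0 0).re • ξ 1 - B 1 0 * ξ 0)]

/-- Adjointness of multiplication and invariance of the inner product under conjugation bring each
off-diagonal term into the form `⟪η α, ·⟫`; Hermitian symmetry identifies `star (B 1 0)` with `B 0
1`. -/
theorem mixedDet_symTensor {ξ η : Fin 2 → Octonion} {B : OctonionMatrix} (hB : B.IsHermitian) :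
    mixedDet (symTensor ξ η) B = ∑ α, ⟪η α, flux ξ B α⟫ := by
  have hre : ∀ x y : Octonion, (x + y).re = x.re + y.re := fun _ _ => rfl
  have hres : ∀ (c : ℝ) (x : Octonion), (c • x).re = c * x.re := fun _ _ => rfl
  have h01 : star (B 1 0) = B 0 1 := hB.apply 0 1
  have h10 : star (B 0 1) = B 1 0 := hB.apply 1 0
  have e1 : ⟪ξ 0 * star (η 1), B 0 1⟫ = ⟪η 1, B 1 0 * ξ 0⟫ := by
    calc ⟪ξ 0 * star (η 1), B 0 1⟫ = ⟪star (η 1), star (ξ 0) * B 0 1⟫ := inner_mul_left _ _ _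
      _ = ⟪η 1, star (star (ξ 0) * B 0 1)⟫ := by rw [← inner_star_star, conj_conj]
      _ = ⟪η 1, B 1 0 * ξ 0⟫ := by rw [conj_mul, conj_conj, h10]
  have e2 : ⟪η 0 * star (ξ 1), B 0 1⟫ = ⟪η 0, B 0 1 * ξ 1⟫ := by
    rw [inner_mul_right, conj_conj]
  simp only [mixedDet, symTensor, tensorStar, Matrix.smul_apply, Matrix.add_apply, Matrix.of_apply,
    flux, Fin.sum_univ_two, Matrix.cons_val_zero, Matrix.cons_val_one, hres, hre, smul_mul,
    re_eq_inner_star, conj_conj, h01, inner_smul_right, inner_add_left,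
    inner_sub_right, e1, e2, real_inner_comm (ξ 0) (η 0), real_inner_comm (ξ 1) (η 1)]
  ring

/-- The divergence of the flux field: if the derivatives `W` of `B` satisfy the closedness
relation and the derivatives `H` of `ξ` are symmetric, only the terms with `H` remain. -/
theorem sum_flux_deriv {B : OctonionMatrix} (hB : B.IsHermitian) {X : Fin 2 → Octonion}
    {H : Fin 2 → Fin 8 → Fin 2 → Octonion} {W : Fin 2 → Fin 8 → OctonionMatrix}
    (hH : ∀ p q, H 0 p 1 q = H 1 q 0 p) (hW : ∀ β p, (W β p).IsHermitian)
    (hc : ∀ α β : Fin 2, α ≠ β → ∑ p, W β p α β * e p = ∑ p, e p * W α p β β) :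
    ∑ p, (1 / 2 : ℝ) * ((B 1 1).re * H 0 p 0 p + (W 0 p 1 1).re * X 0 p
        - (B 0 1 * H 0 p 1 + W 0 p 0 1 * X 1) p) +
      ∑ p, (1 / 2 : ℝ) * ((B 0 0).re * H 1 p 1 p + (W 1 p 0 0).re * X 1 p
        - (B 1 0 * H 1 p 0 + W 1 p 1 0 * X 0) p) =
    mixedDet (Matrix.of fun α β => ∑ p, e p * star (H α p β)) B := by
  have h01 : star (B 1 0) = B 0 1 := hB.apply 0 1
  have h10 : star (B 0 1) = B 1 0 := hB.apply 1 0
  -- Closedness paired with `X α`. The right-hand side is scalar because the diagonal entries of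
  -- Hermitian matrices are real; the identity cancels every term containing `W`.
  have hclosed : ∀ α β : Fin 2, α ≠ β →
      ∑ p, (W β p β α * X α) p = ∑ p, (W α p β β).re * X α p := by
    intro α β hαβ
    calc ∑ p, (W β p β α * X α) p = ⟪∑ p, W β p α β * e p, X α⟫ := by
          rw [sum_inner]
          refine Finset.sum_congr rfl fun p _ => ?_
          rw [inner_mul_left, inner_e_left, (hW β p).apply β α]
      _ = ⟪∑ p, e p * W α p β β, X α⟫ := by rw [hc α β hαβ]
      _ = _ := by
          rw [sum_inner]
          refine Finset.sum_congr rfl fun p _ => ?_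
          have h0 := eq_re_smul_of_star_eq ((hW α p).apply β β)
          conv_lhs => rw [h0]
          rw [mul_re_smul_e_zero, real_inner_smul_left, inner_e_left]
  have hdiag : ∀ α, (∑ p, e p * star (H α p α)).re = ∑ p, H α p α p := by
    intro α
    have : (∑ p, e p * star (H α p α)).re = ∑ p, (e p * star (H α p α)).re := by
      simp [Octonion.re]
    rw [this]
    exact Finset.sum_congr rfl fun p _ => by rw [mul_star_re, inner_e_left]
  have hoff1 : ((∑ p, e p * star (H 0 p 1)) * B 1 0).re = ∑ p, (B 0 1 * H 0 p 1) p := by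
    rw [re_eq_inner_star, h01, sum_inner]
    exact Finset.sum_congr rfl fun p _ => by rw [inner_mul_right, conj_conj, inner_e_left]
  -- Left multiplication by `B 1 0 = star (B 0 1)` is the adjoint of that by `B 0 1`. Together with
  -- the symmetry of `H`, this makes both sides the same double sum.
  have hoff2 : ∑ p, (B 0 1 * H 0 p 1) p = ∑ p, (B 1 0 * H 1 p 0) p := by
    have er : ∀ p, (B 1 0 * H 1 p 0) p = ∑ q, H 0 q 1 p * (B 0 1 * e p) q := by
      intro p
      rw [← inner_e_left, real_inner_comm, inner_mul_left, h01, inner_eq_sum]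
      exact Finset.sum_congr rfl fun q _ => by rw [hH]
    simp_rw [er, mul_apply_eq_sum (B 0 1) (H 0 _ 1)]
    exact Finset.sum_comm
  have hadd : ∀ (x y : Octonion) (p : Fin 8), (x + y) p = x p + y p := fun _ _ _ => rfl
  simp only [mixedDet, Matrix.of_apply, hdiag, hoff1, hadd, ← Finset.mul_sum,
    Finset.sum_sub_distrib, Finset.sum_add_distrib]
  rw [hclosed 1 0 (by decide), hclosed 0 1 (by decide), ← hoff2]
  ring

end OctonionMatrix

namespace Octonion

/-- Octonionic multiplication as a continuous bilinear map. -/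
def mulL : Octonion →L[ℝ] Octonion →L[ℝ] Octonion :=
  (LinearMap.mk₂ ℝ (fun x y : Octonion => x * y) add_mul smul_mul mul_add
    mul_smul).toContinuousBilinearMap

end Octonion

/-! ### Calculus on the octonionic plane and the integral formula -/

namespace OctonionPlane

open Octonion OctonionMatrix

variable {s : Set OctonionPlane}

theorem differential_apply (u : OctonionPlane → ℝ) (x : OctonionPlane) (α : Fin 2) (p : Fin 8) :
    differential s u x α p = pderiv s α p u x := by
  rw [differential]
  simp [e, Pi.single_apply]

theorem contDiffOn_pderiv (hs : UniqueDiffOn ℝ s) {u : OctonionPlane → ℝ}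
    (hu : ContDiffOn ℝ 2 u s) (α : Fin 2) (p : Fin 8) : ContDiffOn ℝ 1 (pderiv s α p u) s :=
  (hu.fderivWithin hs (by norm_num)).clm_apply contDiffOn_const

theorem contDiffOn_differential (hs : UniqueDiffOn ℝ s) {u : OctonionPlane → ℝ}
    (hu : ContDiffOn ℝ 2 u s) (α : Fin 2) : ContDiffOn ℝ 1 (fun x => differential s u x α) s :=
  ContDiffOn.sum fun p _ => (contDiffOn_pderiv hs hu α p).smul contDiffOn_const

theorem continuousOn_pderiv {F : Type*} [NormedAddCommGroup F] [NormedSpace ℝ F]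
    (hs : UniqueDiffOn ℝ s) {f : OctonionPlane → F} (hf : ContDiffOn ℝ 1 f s) (α : Fin 2)
    (p : Fin 8) : ContinuousOn (pderiv s α p f) s :=
  (hf.continuousOn_fderivWithin hs le_rfl).clm_apply continuousOn_const

theorem continuousOn_differential (hs : UniqueDiffOn ℝ s) {u : OctonionPlane → ℝ}
    (hu : ContDiffOn ℝ 1 u s) (α : Fin 2) : ContinuousOn (fun x => differential s u x α) s :=
  continuousOn_finsetSum _ fun p _ => (continuousOn_pderiv hs hu α p).smul continuousOn_const

theorem dScalar_eq_star_differential (u : OctonionPlane → ℝ) (x : OctonionPlane) (α : Fin 2) :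
    dScalar s α u x = conjL (differential s u x α) := by
  simp [dScalar, differential, ← conjL_apply]

theorem pderiv_clm_comp {F G : Type*} [NormedAddCommGroup F] [NormedSpace ℝ F]
    [NormedAddCommGroup G] [NormedSpace ℝ G] (L : F →L[ℝ] G) {f : OctonionPlane → F}
    {x : OctonionPlane} (hs : UniqueDiffWithinAt ℝ s x) (hf : DifferentiableWithinAt ℝ f s x)
    (α : Fin 2) (p : Fin 8) : pderiv s α p (fun y => L (f y)) x = L (pderiv s α p f x) := by
  have := (L.hasFDerivAt.comp_hasFDerivWithinAt x hf.hasFDerivWithinAt).fderivWithin hs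
  rw [pderiv, pderiv, show (fun y => L (f y)) = L ∘ f from rfl, this]
  rfl

theorem pderiv_congr {F : Type*} [NormedAddCommGroup F] [NormedSpace ℝ F]
    {f g : OctonionPlane → F} (h : ∀ y ∈ s, f y = g y) {x : OctonionPlane} (hx : x ∈ s)
    (α : Fin 2) (p : Fin 8) : pderiv s α p f x = pderiv s α p g x := by
  rw [pderiv, pderiv, fderivWithin_congr h (h x hx)]

/-- Conjugation is real-linear and so commutes with partial derivatives; the Hessian then has the
form occurring in `sum_flux_deriv`. -/
theorem hess_apply (hs : UniqueDiffOn ℝ s) {u : OctonionPlane → ℝ} (hu : ContDiffOn ℝ 2 u s)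
    {x : OctonionPlane} (hx : x ∈ s) :
    hess s u x = Matrix.of fun α β =>
      ∑ p, e p * star (pderiv s α p (fun y => differential s u y β) x) := by
  ext1 α β
  simp only [hess, Matrix.of_apply, dbar]
  refine Finset.sum_congr rfl fun p _ => ?_
  rw [← conjL_apply, ← pderiv_clm_comp conjL (hs x hx)
    ((contDiffOn_differential hs hu β).differentiableOn one_ne_zero x hx)]
  simp_rw [← dScalar_eq_star_differential]

/-- Second derivatives commute up to the boundary. -/
theorem pderiv_differential_symm (hs : UniqueDiffOn ℝ s) {u : OctonionPlane → ℝ}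
    (hu : ContDiffOn ℝ 2 u s) {x : OctonionPlane} (hx : x ∈ s) (hxi : x ∈ closure (interior s))
    (α β : Fin 2) (p q : Fin 8) :
    pderiv s α p (fun y => differential s u y β) x q =
      pderiv s β q (fun y => differential s u y α) x p := by
  have key : ∀ (α β : Fin 2) (p q : Fin 8),
      pderiv s α p (fun y => differential s u y β) x q =
        fderivWithin ℝ (fderivWithin ℝ u s) s x (EuclideanSpace.single (α, p) 1)
          (EuclideanSpace.single (β, q) 1) := by
    intro α β p q
    have h1 := pderiv_clm_comp (EuclideanSpace.proj q : Octonion →L[ℝ] ℝ) (hs x hx)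
      ((contDiffOn_differential hs hu β).differentiableOn one_ne_zero x hx) α p
    have h2 := pderiv_clm_comp
      (ContinuousLinearMap.apply ℝ ℝ (EuclideanSpace.single (β, q) (1 : ℝ) : OctonionPlane))
      (hs x hx) ((hu.fderivWithin hs (m := 1) (by norm_num)).differentiableOn one_ne_zero x hx) α p
    simp only [PiLp.proj_apply, differential_apply] at h1
    rw [← h1]
    exact h2
  rw [key, key]
  exact (hu x hx).isSymmSndFDerivWithinAt (by simp) hs hxi hx _ _

section Flux

variable {u : OctonionPlane → ℝ} {ω : OctonionPlane → OctonionMatrix}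

theorem contDiffOn_flux (hs : UniqueDiffOn ℝ s) (hu : ContDiffOn ℝ 2 u s)
    (hω : ∀ α β : Fin 2, ContDiffOn ℝ 1 (fun x => ω x α β) s) (α : Fin 2) :
    ContDiffOn ℝ 1 (fun x => flux (differential s u x) (ω x) α) s := by
  have hξ := contDiffOn_differential hs hu
  have hre : ∀ α β, ContDiffOn ℝ 1 (fun x => (ω x α β).re) s := fun α β =>
    (EuclideanSpace.proj (0 : Fin 8) : Octonion →L[ℝ] ℝ).contDiff.comp_contDiffOn (hω α β)
  have hmul : ∀ α β γ, ContDiffOn ℝ 1 (fun x => ω x α β * differential s u x γ) s := fun α β γ =>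
    (mulL.contDiff.comp_contDiffOn (hω α β)).clm_apply (hξ γ)
  fin_cases α
  · exact (((hre 1 1).smul (hξ 0)).sub (hmul 0 1 1)).const_smul (1 / 2 : ℝ)
  · exact (((hre 0 0).smul (hξ 1)).sub (hmul 1 0 0)).const_smul (1 / 2 : ℝ)

theorem pderiv_re_smul_sub_mul {a b ξ η : OctonionPlane → Octonion} {x : OctonionPlane}
    (hs : UniqueDiffWithinAt ℝ s x)
    (ha : DifferentiableWithinAt ℝ a s x) (hb : DifferentiableWithinAt ℝ b s x)
    (hξ : DifferentiableWithinAt ℝ ξ s x) (hη : DifferentiableWithinAt ℝ η s x)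
    (α : Fin 2) (p : Fin 8) :
    pderiv s α p (fun y => (1 / 2 : ℝ) • ((a y).re • ξ y - b y * η y)) x p =
      (1 / 2 : ℝ) * ((a x).re * pderiv s α p ξ x p + (pderiv s α p a x).re * ξ x p
        - (b x * pderiv s α p η x + pderiv s α p b x * η x) p) := by
  have hre : HasFDerivWithinAt (fun y => (a y).re)
      ((EuclideanSpace.proj (0 : Fin 8) : Octonion →L[ℝ] ℝ) ∘L fderivWithin ℝ a s x) s x :=
    (EuclideanSpace.proj (0 : Fin 8) : Octonion →L[ℝ] ℝ).hasFDerivAt.comp_hasFDerivWithinAt x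
      ha.hasFDerivWithinAt
  have h1 := hre.fun_smul hξ.hasFDerivWithinAt
  have h2 := mulL.hasFDerivWithinAt_of_bilinear hb.hasFDerivWithinAt hη.hasFDerivWithinAt
  have h3 := ((h1.fun_sub h2).const_smul (1 / 2 : ℝ)).fderivWithin hs
  have h4 : pderiv s α p (fun y => (1 / 2 : ℝ) • ((a y).re • ξ y - b y * η y)) x =
      (1 / 2 : ℝ) • ((a x).re • pderiv s α p ξ x + (pderiv s α p a x).re • ξ x
        - (b x * pderiv s α p η x + pderiv s α p b x * η x)) := by
    have h5 := congrArg (fun L => L (EuclideanSpace.single (α, p) (1 : ℝ) : OctonionPlane)) h3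
    exact h5
  rw [h4]
  simp

/-- The divergence of the flux field is `det (Hess u, ω)` if `ω` is closed. -/
theorem sum_pderiv_flux {Ω : Set OctonionPlane} (hΩ : IsOpen Ω)
    (hs : UniqueDiffOn ℝ (closure Ω)) (hu : ContDiffOn ℝ 2 u (closure Ω))
    (hωH : ∀ x ∈ closure Ω, (ω x).IsHermitian)
    (hω : ∀ α β : Fin 2, ContDiffOn ℝ 1 (fun x => ω x α β) (closure Ω)) (hωc : IsClosedOn Ω ω)
    {x : OctonionPlane} (hx : x ∈ Ω) :
    ∑ α, ∑ p, pderiv (closure Ω) α p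
        (fun y => flux (differential (closure Ω) u y) (ω y) α) x p =
      mixedDet (hess (closure Ω) u x) (ω x) := by
  have hxc : x ∈ closure Ω := subset_closure hx
  have hn : closure Ω ∈ 𝓝 x := mem_of_superset (hΩ.mem_nhds hx) subset_closure
  have hxi : x ∈ closure (interior (closure Ω)) := subset_closure (mem_interior_iff_mem_nhds.2 hn)
  have hd := fun α => (contDiffOn_differential hs hu α).differentiableOn one_ne_zero x hxc
  have hdω := fun α β => (hω α β).differentiableOn one_ne_zero x hxc
  rw [hess_apply hs hu hxc, ← sum_flux_deriv (hωH x hxc) (X := differential (closure Ω) u x)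
    (W := fun β p => Matrix.of fun α γ => pderiv (closure Ω) β p (fun y => ω y α γ) x)
    (fun p q => pderiv_differential_symm hs hu hxc hxi 0 1 p q) ?_ ?_, Fin.sum_univ_two]
  · congr 1
    · exact Finset.sum_congr rfl fun p _ =>
        pderiv_re_smul_sub_mul (hs x hxc) (hdω 1 1) (hdω 0 1) (hd 0) (hd 1) 0 p
    · exact Finset.sum_congr rfl fun p _ =>
        pderiv_re_smul_sub_mul (hs x hxc) (hdω 0 0) (hdω 1 0) (hd 1) (hd 0) 1 p
  -- Differentiating the Hermitian relation shows that the derivatives of `ω` are Hermitian too.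
  · intro β p
    ext1 α γ
    change star (pderiv (closure Ω) β p (fun y => ω y γ α) x) =
      pderiv (closure Ω) β p (fun y => ω y α γ) x
    rw [← conjL_apply, ← pderiv_clm_comp conjL (hs x hxc) (hdω γ α)]
    exact pderiv_congr (fun y hy => (hωH y hy).apply α γ) hxc β p
  · intro α β hαβ
    -- Closedness is stated with derivatives within `Ω`; at points of `Ω` they agree with those
    -- within `closure Ω`.
    have hopen : ∀ (γ : Fin 2) (p : Fin 8) (F : OctonionPlane → Octonion),
        pderiv (closure Ω) γ p F x = pderiv Ω γ p F x := by
      intro γ p F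
      rw [pderiv, pderiv, fderivWithin_of_mem_nhds hn, fderivWithin_of_isOpen hΩ hx]
    simp only [Matrix.of_apply, hopen]
    exact hωc x hx α β hαβ

end Flux

theorem isC1Domain {Ω : Set OctonionPlane} (hΩ : IsOpen Ω) (hΩb : Bornology.IsBounded Ω)
    {ϱ : OctonionPlane → ℝ} (hϱ : IsDefiningFunction Ω ϱ) : IsC1Domain Ω ϱ :=
  ⟨hΩ, hΩb, hϱ.contDiffOn, hϱ.neg, hϱ.eq_zero, hϱ.grad_ne_zero⟩

theorem inner_unitNormal_single {Ω : Set OctonionPlane} (ϱ : OctonionPlane → ℝ)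
    (x : OctonionPlane) (α : Fin 2) (p : Fin 8) :
    ⟪unitNormal Ω ϱ x, EuclideanSpace.single (α, p) (1 : ℝ)⟫ =
      ‖gradientWithin ϱ (closure Ω) x‖⁻¹ * differential (closure Ω) ϱ x α p := by
  rw [unitNormal, real_inner_smul_left, inner_gradientWithin_left, differential_apply, pderiv]

/-- The divergence theorem for the vector field `v G` on the octonionic plane. -/
theorem setIntegral_divergence {Ω : Set OctonionPlane} {ϱ : OctonionPlane → ℝ}
    (h : IsC1Domain Ω ϱ) {v : OctonionPlane → ℝ} (hv : ContDiffOn ℝ 1 v (closure Ω))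
    {G : OctonionPlane → Fin 2 → Octonion}
    (hG : ∀ α, ContDiffOn ℝ 1 (fun x => G x α) (closure Ω)) :
    ∫ x in Ω, (v x * (∑ α, ∑ p, pderiv (closure Ω) α p (fun y => G y α) x p) +
        ∑ α, ⟪differential (closure Ω) v x α, G x α⟫) =
      ∫ x, v x * (∑ α, ⟪differential (closure Ω) ϱ x α, G x α⟫) *
        (1 / ‖gradientWithin ϱ (closure Ω) x‖) ∂(surfaceMeasure Ω) := by
  have hd : Module.finrank ℝ OctonionPlane = 15 + 1 := by simp
  have hs := h.uniqueDiffOn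
  have hGp : ∀ α p, ContDiffOn ℝ 1 (fun x => G x α p) (closure Ω) := fun α p =>
    (EuclideanSpace.proj p : Octonion →L[ℝ] ℝ).contDiff.comp_contDiffOn (hG α)
  have hvG : ∀ α p, ContDiffOn ℝ 1 (fun x => v x * G x α p) (closure Ω) := fun α p =>
    hv.mul (hGp α p)
  have hdiv : ∀ α p, ∫ x in Ω, pderiv (closure Ω) α p (fun x => v x * G x α p) x =
      ∫ x, v x * G x α p * ⟪unitNormal Ω ϱ x, EuclideanSpace.single (α, p) (1 : ℝ)⟫
        ∂(surfaceMeasure Ω) := fun α p =>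
    h.setIntegral_fderivWithin_eq hd (hvG α p) (EuclideanSpace.single (α, p) (1 : ℝ))
  have hint1 : ∀ α p, IntegrableOn (pderiv (closure Ω) α p (fun x => v x * G x α p)) Ω :=
    fun α p => h.integrableOn_fderivWithin_apply (hvG α p) _
  have hint2 : ∀ α p, Integrable (fun x => v x * G x α p *
      ⟪unitNormal Ω ϱ x, EuclideanSpace.single (α, p) (1 : ℝ)⟫) (surfaceMeasure Ω) := fun α p =>
    h.integrableOn_frontier hd (((hvG α p).continuousOn.mono frontier_subset_closure).mul
      (h.continuousOn_inner_unitNormal _))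
  have hleft : ∫ x in Ω, (v x * (∑ α, ∑ p, pderiv (closure Ω) α p (fun y => G y α) x p) +
        ∑ α, ⟪differential (closure Ω) v x α, G x α⟫) =
      ∑ α, ∑ p, ∫ x in Ω, pderiv (closure Ω) α p (fun x => v x * G x α p) x := by
    simp_rw [← integral_finsetSum Finset.univ fun p _ => hint1 _ p]
    rw [← integral_finsetSum Finset.univ fun α _ => integrable_finsetSum _ fun p _ => hint1 α p]
    refine setIntegral_congr_fun h.isOpen.measurableSet fun x hx => ?_
    have hxc := subset_closure hx
    simp only [Finset.mul_sum, ← Finset.sum_add_distrib, inner_eq_sum]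
    refine Finset.sum_congr rfl fun α _ => Finset.sum_congr rfl fun p _ => ?_
    have h1 := fderivWithin_fun_mul (hs x hxc) (hv.differentiableOn one_ne_zero x hxc)
      ((hGp α p).differentiableOn one_ne_zero x hxc)
    have h2 := pderiv_clm_comp (EuclideanSpace.proj p : Octonion →L[ℝ] ℝ) (hs x hxc)
      ((hG α).differentiableOn one_ne_zero x hxc) α p
    simp only [PiLp.proj_apply] at h2
    rw [differential_apply, ← h2, pderiv, pderiv, pderiv, h1]
    simp [mul_comm]
  have hright : ∫ x, v x * (∑ α, ⟪differential (closure Ω) ϱ x α, G x α⟫) *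
        (1 / ‖gradientWithin ϱ (closure Ω) x‖) ∂(surfaceMeasure Ω) =
      ∑ α, ∑ p, ∫ x, v x * G x α p *
        ⟪unitNormal Ω ϱ x, EuclideanSpace.single (α, p) (1 : ℝ)⟫ ∂(surfaceMeasure Ω) := by
    simp_rw [← integral_finsetSum Finset.univ fun p _ => hint2 _ p]
    rw [← integral_finsetSum Finset.univ fun α _ => integrable_finsetSum _ fun p _ => hint2 α p]
    congr 1 with x
    simp only [Finset.mul_sum, Finset.sum_mul, inner_eq_sum, inner_unitNormal_single]
    refine Finset.sum_congr rfl fun α _ => Finset.sum_congr rfl fun p _ => ?_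
    ring
  rw [hleft, hright]
  simp_rw [hdiv]

theorem continuousOn_mixedDet {A B : OctonionPlane → OctonionMatrix}
    (hA : ∀ α β, ContinuousOn (fun x => A x α β) s)
    (hB : ∀ α β, ContinuousOn (fun x => B x α β) s) :
    ContinuousOn (fun x => mixedDet (A x) (B x)) s := by
  have hre : ∀ {F : OctonionPlane → Octonion}, ContinuousOn F s →
      ContinuousOn (fun x => (F x).re) s := fun hF =>
    (EuclideanSpace.proj (0 : Fin 8) : Octonion →L[ℝ] ℝ).continuous.comp_continuousOn hF
  have hmul : ContinuousOn (fun x => A x 0 1 * B x 1 0) s :=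
    (mulL.continuous.comp_continuousOn (hA 0 1)).clm_apply (hB 1 0)
  exact continuousOn_const.mul ((((hre (hA 0 0)).mul (hre (hB 1 1))).add
    ((hre (hA 1 1)).mul (hre (hB 0 0)))).sub (continuousOn_const.mul (hre hmul)))

theorem continuousOn_hess (hs : UniqueDiffOn ℝ s) {u : OctonionPlane → ℝ}
    (hu : ContDiffOn ℝ 2 u s) (α β : Fin 2) : ContinuousOn (fun x => hess s u x α β) s := by
  refine ContinuousOn.congr (f := fun x =>
    ∑ p, mulLeftL (e p) (conjL (pderiv s α p (fun y => differential s u y β) x))) ?_ fun x hx => ?_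
  · exact continuousOn_finsetSum _ fun p _ => (mulLeftL (e p)).continuous.comp_continuousOn
      (conjL.continuous.comp_continuousOn
        (continuousOn_pderiv hs (contDiffOn_differential hs hu β) α p))
  · rw [hess_apply hs hu hx]
    rfl

theorem continuousOn_symTensor {ξ η : OctonionPlane → Fin 2 → Octonion}
    (hξ : ∀ α, ContinuousOn (fun x => ξ x α) s) (hη : ∀ α, ContinuousOn (fun x => η x α) s)
    (α β : Fin 2) : ContinuousOn (fun x => symTensor (ξ x) (η x) α β) s := by
  have hmul : ∀ {ξ η : OctonionPlane → Octonion}, ContinuousOn ξ s → ContinuousOn η s →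
      ContinuousOn (fun x => ξ x * star (η x)) s := fun hξ hη =>
    (mulL.continuous.comp_continuousOn hξ).clm_apply (conjL.continuous.comp_continuousOn hη)
  exact ((hmul (hξ α) (hη β)).add (hmul (hη α) (hξ β))).const_smul (1 / 2 : ℝ)

end OctonionPlane

theorem lemma1p1
    (Ω : Set OctonionPlane) (hΩ : IsOpen Ω) (hΩc : IsConnected Ω) (hΩb : Bornology.IsBounded Ω)
    (ϱ : OctonionPlane → ℝ) (hϱ : OctonionPlane.IsDefiningFunction Ω ϱ)
    (u v : OctonionPlane → ℝ)
    (hu : ContDiffOn ℝ 2 u (closure Ω)) (hv : ContDiffOn ℝ 1 v (closure Ω))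
    (ω : OctonionPlane → OctonionMatrix)
    (hωH : ∀ x ∈ closure Ω, (ω x).IsHermitian)
    (hω : ∀ α β : Fin 2, ContDiffOn ℝ 1 (fun x => ω x α β) (closure Ω))
    (hωc : OctonionPlane.IsClosedOn Ω ω) :
    IntegrableOn (fun x => v x *
      OctonionMatrix.mixedDet (OctonionPlane.hess (closure Ω) u x) (ω x)) Ω volume ∧
    IntegrableOn (fun x => OctonionMatrix.mixedDet
      (OctonionMatrix.symTensor (OctonionPlane.differential (closure Ω) u x)
        (OctonionPlane.differential (closure Ω) v x)) (ω x)) Ω volume ∧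
    Integrable (fun x => v x * OctonionMatrix.mixedDet
      (OctonionMatrix.symTensor (OctonionPlane.differential (closure Ω) u x)
        (OctonionPlane.differential (closure Ω) ϱ x)) (ω x) *
      (1 / ‖gradientWithin ϱ (closure Ω) x‖)) (OctonionPlane.surfaceMeasure Ω) ∧
    ∫ x in Ω, v x * OctonionMatrix.mixedDet (OctonionPlane.hess (closure Ω) u x) (ω x) =
      -(∫ x in Ω, OctonionMatrix.mixedDet
          (OctonionMatrix.symTensor (OctonionPlane.differential (closure Ω) u x)
            (OctonionPlane.differential (closure Ω) v x)) (ω x)) +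
      ∫ x, v x * OctonionMatrix.mixedDet
          (OctonionMatrix.symTensor (OctonionPlane.differential (closure Ω) u x)
            (OctonionPlane.differential (closure Ω) ϱ x)) (ω x) *
          (1 / ‖gradientWithin ϱ (closure Ω) x‖) ∂(OctonionPlane.surfaceMeasure Ω) := by
  have h := OctonionPlane.isC1Domain hΩ hΩb hϱ
  have hs := h.uniqueDiffOn
  have hd : Module.finrank ℝ OctonionPlane = 15 + 1 := by simp
  have hωc' := fun α β => (hω α β).continuousOn
  -- All integrands are continuous up to the boundary. This gives integrability on the compact
  -- closure, and on the boundary because its area is finite.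
  have hint : ∀ {f : OctonionPlane → ℝ}, ContinuousOn f (closure Ω) → IntegrableOn f Ω volume :=
    fun hf => (hf.integrableOn_compact hΩb.isCompact_closure).mono_set subset_closure
  have hu1 : ContDiffOn ℝ 1 u (closure Ω) := hu.of_le (by norm_num)
  have hcu := OctonionPlane.continuousOn_differential hs hu1
  have hint1 := hint (f := fun x => v x * OctonionMatrix.mixedDet
    (OctonionPlane.hess (closure Ω) u x) (ω x)) (hv.continuousOn.mul (OctonionPlane.continuousOn_mixedDet
    (OctonionPlane.continuousOn_hess hs hu) hωc'))
  have hint2 := hint (OctonionPlane.continuousOn_mixedDet (OctonionPlane.continuousOn_symTensor hcu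
    (OctonionPlane.continuousOn_differential hs hv)) hωc')
  have hgrad : ContinuousOn (fun x => 1 / ‖gradientWithin ϱ (closure Ω) x‖) (frontier Ω) :=
    continuousOn_const.div
      ((continuousOn_gradientWithin hs hϱ.contDiffOn).mono frontier_subset_closure).norm
      fun x hx => norm_ne_zero_iff.2 (hϱ.grad_ne_zero x hx)
  have hint3 := h.integrableOn_frontier hd (((hv.continuousOn.mul
    (OctonionPlane.continuousOn_mixedDet (OctonionPlane.continuousOn_symTensor hcu
    (OctonionPlane.continuousOn_differential hs hϱ.contDiffOn)) hωc')).mono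
      frontier_subset_closure).mul hgrad)
  refine ⟨hint1, hint2, hint3, ?_⟩
  -- The divergence theorem for `v G`, where `G` is the flux field of `du` and `ω`, which is `C¹`
  -- because `u` is `C²`.
  have key := OctonionPlane.setIntegral_divergence h hv
    (OctonionPlane.contDiffOn_flux hs hu hω)
  have hleft : ∫ x in Ω, (v x * (∑ α, ∑ p, OctonionPlane.pderiv (closure Ω) α p (fun y =>
      OctonionMatrix.flux (OctonionPlane.differential (closure Ω) u y) (ω y) α) x p) +
        ∑ α, ⟪OctonionPlane.differential (closure Ω) v x α,
          OctonionMatrix.flux (OctonionPlane.differential (closure Ω) u x) (ω x) α⟫) =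
      (∫ x in Ω, v x * OctonionMatrix.mixedDet (OctonionPlane.hess (closure Ω) u x) (ω x)) +
      ∫ x in Ω, OctonionMatrix.mixedDet
          (OctonionMatrix.symTensor (OctonionPlane.differential (closure Ω) u x)
            (OctonionPlane.differential (closure Ω) v x)) (ω x) := by
    rw [← integral_add hint1 hint2]
    refine setIntegral_congr_fun hΩ.measurableSet fun x hx => ?_
    simp only [OctonionPlane.sum_pderiv_flux hΩ hs hu hωH hω hωc hx,
      OctonionMatrix.mixedDet_symTensor (hωH x (subset_closure hx))]
  have hright : ∫ x, v x * (∑ α, ⟪OctonionPlane.differential (closure Ω) ϱ x α,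
          OctonionMatrix.flux (OctonionPlane.differential (closure Ω) u x) (ω x) α⟫) *
        (1 / ‖gradientWithin ϱ (closure Ω) x‖) ∂(OctonionPlane.surfaceMeasure Ω) =
      ∫ x, v x * OctonionMatrix.mixedDet
          (OctonionMatrix.symTensor (OctonionPlane.differential (closure Ω) u x)
            (OctonionPlane.differential (closure Ω) ϱ x)) (ω x) *
          (1 / ‖gradientWithin ϱ (closure Ω) x‖) ∂(OctonionPlane.surfaceMeasure Ω) := by
    refine setIntegral_congr_fun isClosed_frontier.measurableSet fun x hx => ?_
    simp only [OctonionMatrix.mixedDet_symTensor (hωH x (frontier_subset_closure hx))]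
  rw [hleft, hright] at key
  linarith

end
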